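/- Let $n\ge 0$, let $U\subset\mathbb{C}^n$ be an open neighbourhood of $0$, and let $F:U\to F(U)$ be a biholomorphism onto an open subset of $\mathbb{C}^n$ such that $F(0)=0$, the closure of $F(U)$ is compact and contained in $U$, and $F$ is contracting, i.e. all eigenvalues of its linear part $L=DF(0)$ have modulus $<1$. If $U$ is not connected, assume also that every forward orbit of $F$ enters the connected component of $U$ that contains $0$. The Hopf manifold of $F$ is the quotient $M$ of $U\setminus\{0\}$ by the equivalence relation generated by $z\sim F(z)$, with projection $\pi:U\setminus\{0\}\to M$. Write $\mathbb{C}^n=\bigoplus_\lambda E_\lambda$ for the decomposition into the generalized eigenspaces of $L$, where $\lambda$ runs over the distinct eigenvalues of $L$. A polynomial map $Q:\mathbb{C}^n\to\mathbb{C}^n$ with $Q(0)=0$ is of type $s=(s_\lambda)_\lambda$, $s_\lambda\in\mathbb{Z}_{\ge0}$, if $Q(\sum_\lambda a_\lambda t_\lambda)=\bigl(\prod_\lambda a_\lambda^{s_\lambda}\bigr)Q(\sum_\lambda t_\lambda)$ for all $a_\lambda\in\mathbb{C}$, $t_\lambda\in E_\lambda$. A polynomial map fixing $0$ is sub-resonant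 relative to $L$ if for every eigenvalue $\mu$ its component in $E_\mu$ is a finite sum of maps of types $s$ with $\ln|\mu|\le\sum_\lambda s_\lambda\ln|\lambda|$. Let $SR^*(L)$ be the set of sub-resonant maps whose derivative at $0$ is invertible, and let $G$ be the group of transformations of $\mathbb{C}^n$ generated by $SR^*(L)$ and the translations. Then: 1. $X=\mathbb{C}^n$ is a holomorphic homogeneous $G$-space: $G$ carries the structure of a (finite-dimensional, Hausdorff, second countable) complex Lie group for which the action $G\times X\to X$ is holomorphic, and this action is transitive. 2. $M$ is a Hausdorff, second countable space, and it carries a holomorphic $(G,X)$-structure: an atlas of $X$-valued charts whose changes of charts coincide, near every point of their domain, with elements of $G$. The complex structure that this atlas defines on $M$ is the quotient one, i.e. $\pi$ is a local biholomorphism. -/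

import Mathlib

open scoped Topology Manifold ContDiff

/-- The space `ℂⁿ`. -/
abbrev Cn (n : ℕ) : Type := EuclideanSpace ℂ (Fin n)

/-! ### Sub-resonance type polynomials -/

/-- A polynomial map `ℂⁿ → ℂⁿ`: every coordinate is a polynomial function. -/
def IsPolynomialMap {n : ℕ} (P : Cn n → Cn n) : Prop :=
  ∀ i : Fin n, ∃ p : MvPolynomial (Fin n) ℂ, ∀ z : Cn n, P z i = MvPolynomial.eval (fun k => z k) p

/-- `P` is homogeneous of type `s = (s_λ)_λ` relative to `L`, where `λ` runs over the (distinct)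
eigenvalues of `L`: `P (∑ a_λ t_λ) = (∏ a_λ ^ s_λ) P (∑ t_λ)` for all scalars `a_λ` and all `t_λ` in
the characteristic (generalized eigen-) space of `L` for `λ`. -/
def IsOfType {n : ℕ} (L : Module.End ℂ (Cn n)) (s : L.Eigenvalues → ℕ) (P : Cn n → Cn n) : Prop :=
  ∀ (a : L.Eigenvalues → ℂ) (t : L.Eigenvalues → Cn n),
    (∀ j : L.Eigenvalues, t j ∈ L.maxGenEigenspace (j : ℂ)) →
      P (∑ j, a j • t j) = (∏ j, a j ^ s j) • P (∑ j, t j)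

/-- A sub-resonant term relative to `L`: a polynomial map fixing `0`, with values in the
characteristic space of one eigenvalue `i`, homogeneous of a type `s` that satisfies
`ln |i| ≤ ∑_j s_j ln |j|`. -/
def IsSubResonantTerm {n : ℕ} (L : Module.End ℂ (Cn n)) (Q : Cn n → Cn n) : Prop :=
  IsPolynomialMap Q ∧ Q 0 = 0 ∧
    ∃ (i : L.Eigenvalues) (s : L.Eigenvalues → ℕ),
      (∀ z, Q z ∈ L.maxGenEigenspace (i : ℂ)) ∧ IsOfType L s Q ∧
        Real.log ‖(i : ℂ)‖ ≤ ∑ j : L.Eigenvalues, (s j : ℝ) * Real.log ‖(j : ℂ)‖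

/-- `SR(L)`: the maps all of whose components in the characteristic spaces of `L` are finite sums of
sub-resonant terms. -/
def SR {n : ℕ} (L : Module.End ℂ (Cn n)) : Submodule ℂ (Cn n → Cn n) :=
  Submodule.span ℂ {Q | IsSubResonantTerm L Q}

/-- `SR*(L)`: the elements of `SR(L)` whose derivative at the origin is invertible. -/
def SRstar {n : ℕ} (L : Module.End ℂ (Cn n)) : Set (Cn n → Cn n) :=
  {P | P ∈ SR L ∧ IsUnit (fderiv ℂ P 0)}

/-- The group `G = ⟨SR*(L), ℂⁿ⟩` of transformations of `ℂⁿ` generated by `SR*(L)` and by the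
translations. -/
def subResonantAffineGroup {n : ℕ} (L : Module.End ℂ (Cn n)) : Subgroup (Equiv.Perm (Cn n)) :=
  Subgroup.closure
    ({g | (g : Cn n → Cn n) ∈ SRstar L} ∪ Set.range fun τ : Cn n => Equiv.addRight τ)

/-! ### Holomorphic homogeneous spaces and `(G, X)`-structures -/

/-- `X = ℂⁿ` is a holomorphic homogeneous `G`-space for the transformation group `G`: the group `G` is
a (finite-dimensional, Hausdorff, second countable) complex Lie group for which the action
`G × X → X` is holomorphic, and the action is transitive. -/
def IsHolomorphicHomogeneousSpace {n : ℕ} (G : Subgroup (Equiv.Perm (Cn n))) : Prop :=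
  (∃ (m : ℕ) (_ : TopologicalSpace G) (_ : ChartedSpace (Cn m) G),
    T2Space G ∧ SecondCountableTopology G ∧ LieGroup 𝓘(ℂ, Cn m) ω G ∧
      ContMDiff (𝓘(ℂ, Cn m).prod 𝓘(ℂ, Cn n)) 𝓘(ℂ, Cn n) ω
        (fun p : G × Cn n => (p.1 : Equiv.Perm (Cn n)) p.2)) ∧
  ∀ x y : Cn n, ∃ g ∈ G, g x = y

/-- The pseudogroup of a transformation group `G` of `X`: the homeomorphisms between open subsets of
`X` that coincide near every point of their domain with an element of `G`. A charted space with this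
structure groupoid (`HasGroupoid`) is a `(G, X)`-structure. -/
def transformationGroupoid {X : Type*} [TopologicalSpace X] (G : Subgroup (Equiv.Perm X)) :
    StructureGroupoid X where
  members := {e | ∀ x ∈ e.source, ∃ g ∈ G, ∀ᶠ y in 𝓝 x, e y = g y}
  trans' := by
    intro e e' he he' x hx
    rw [OpenPartialHomeomorph.trans_source] at hx
    obtain ⟨g, hg, hgx⟩ := he x hx.1
    obtain ⟨g', hg', hgx'⟩ := he' (e x) hx.2
    refine ⟨g' * g, G.mul_mem hg' hg, ?_⟩
    filter_upwards [hgx, (e.continuousAt hx.1).eventually hgx'] with y hy hy'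
    rw [OpenPartialHomeomorph.coe_trans, Function.comp_apply, hy', hy, Equiv.Perm.mul_apply]
  symm' := by
    intro e he y hy
    obtain ⟨g, hg, hgx⟩ := he (e.symm y) (e.map_target hy)
    refine ⟨g⁻¹, G.inv_mem hg, ?_⟩
    filter_upwards [(e.symm.continuousAt hy).eventually hgx, e.open_target.mem_nhds hy] with w hw hwt
    rw [Equiv.Perm.eq_inv_iff_eq, ← hw, e.right_inv hwt]
  id_mem' := fun x _ => ⟨1, G.one_mem, Filter.Eventually.of_forall fun _ => rfl⟩
  locality' := by
    intro e he x hx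
    obtain ⟨s, hs, hxs, h⟩ := he x hx
    exact h x (by rw [OpenPartialHomeomorph.restr_source, hs.interior_eq]; exact ⟨hx, hxs⟩)
  mem_of_eqOnSource' := by
    intro e e' he hee' x hx
    obtain ⟨g, hg, hgx⟩ := he x (hee'.1 ▸ hx)
    refine ⟨g, hg, ?_⟩
    filter_upwards [hgx, e'.open_source.mem_nhds hx] with y hy hys
    rw [hee'.2 hys, hy]

/-! ### Hopf manifolds -/

/-- The linear part of `F` at the origin. -/
noncomputable def linearPart {n : ℕ} (F : Cn n → Cn n) : Module.End ℂ (Cn n) :=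
  (fderiv ℂ F 0 : Cn n →ₗ[ℂ] Cn n)

/-- `F : U → F(U)` is a contracting biholomorphism fixing the origin, where `U = F.source` is an open
neighbourhood of the origin in `ℂⁿ`, `F(U) = F.target`, and `F(U)` is relatively compact in `U`. -/
structure IsHopfContraction {n : ℕ} (F : OpenPartialHomeomorph (Cn n) (Cn n)) : Prop where
  zero_mem : (0 : Cn n) ∈ F.source
  map_zero : F 0 = 0
  holomorphic : DifferentiableOn ℂ F F.source
  holomorphic_symm : DifferentiableOn ℂ F.symm F.target
  contracting : ∀ μ : ℂ, (linearPart F).HasEigenvalue μ → ‖μ‖ < 1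
  isCompact_closure : IsCompact (closure F.target)
  closure_subset : closure F.target ⊆ F.source
  /-- Automatic if `U` is connected. It excludes components of `U` that `F` permutes away from the
  origin; there `F` would have periodic points and the quotient would not be a manifold. -/
  orbit_mem_component :
    ∀ z ∈ F.source, ∃ k : ℕ, F^[k] z ∈ connectedComponentIn F.source 0

/-- The open set `U ∖ {0}`, where `U = F.source`. -/
def puncturedSource {n : ℕ} (F : OpenPartialHomeomorph (Cn n) (Cn n)) :
    TopologicalSpace.Opens (Cn n) :=
  ⟨F.source \ {0}, F.open_source.sdiff isClosed_singleton⟩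

/-- The Hopf manifold: the quotient of `U ∖ {0}` by the equivalence relation generated by
`z ∼ F z`. -/
def HopfManifold {n : ℕ} (F : OpenPartialHomeomorph (Cn n) (Cn n)) : Type :=
  Quot fun z w : puncturedSource F => (w : Cn n) = F z

/-- The quotient topology. -/
instance {n : ℕ} (F : OpenPartialHomeomorph (Cn n) (Cn n)) : TopologicalSpace (HopfManifold F) :=
  inferInstanceAs (TopologicalSpace (Quot _))

/-- The projection of `U ∖ {0}` onto the Hopf manifold. -/
def hopfProj {n : ℕ} (F : OpenPartialHomeomorph (Cn n) (Cn n)) (z : puncturedSource F) :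
    HopfManifold F :=
  Quot.mk _ z

/-! Give the coordinate along a generalized eigenvector for `λ` the weight `-ln |λ|`. The polynomial
maps whose components do not exceed the weight of their coordinate form a finite-dimensional space
closed under composition, and the group generated by `SR*(L)` and the translations consists of the
bijections in this space whose inverse is in it too. It is open in the space, hence a complex Lie
group.

Near the origin, `F` is conjugate to an element `g` of the group: as coordinates one takes functions
that are generalized eigenvectors of the composition operator `h ↦ h ∘ F`. In the expansion of
their images under this operator only resonant monomials survive, the remainder being too flat at
the origin to be a nonzero generalized eigenvector. Every orbit ends up near the origin, so the
conjugation extends to an injective developing map `Ψ` on all of `U` with `Ψ ∘ F = g ∘ Ψ`.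

A compact subset of `U ∖ {0}` is disjoint from its images under the late iterates of `F`, so the
quotient is Hausdorff. The local inverses of `π` followed by `Ψ` are charts which change by powers
of `g`. -/

/-! ### Holomorphic functions of several variables -/

section CauchyFormula

open MeasureTheory Metric

variable {E : Type*} [NormedAddCommGroup E] [NormedSpace ℂ E] {n : ℕ}

lemma continuous_torusMap (c : Fin n → ℂ) (R : Fin n → ℝ) : Continuous (torusMap c R) := by
  unfold torusMap
  fun_prop

lemma dist_torusMap_apply (c : Fin n → ℂ) (R : Fin n → ℝ) (θ : Fin n → ℝ) (i : Fin n) :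
    dist (torusMap c R θ i) (c i) = |R i| := by
  simp [torusMap, dist_eq_norm, Complex.norm_exp_ofReal_mul_I]

lemma torusMap_mem_closedBall (c : Fin n → ℂ) {R : ℝ} (hR : 0 ≤ R) (θ : Fin n → ℝ) :
    torusMap c (fun _ => R) θ ∈ closedBall c R := by
  rw [mem_closedBall, dist_pi_le_iff hR]
  exact fun i => (dist_torusMap_apply ..).trans_le (abs_of_nonneg hR).le

lemma torusMap_sub_ne_zero {c z : Fin n → ℂ} {R : ℝ} (hz : z ∈ ball c R) (θ : Fin n → ℝ)
    (i : Fin n) : torusMap c (fun _ => R) θ i - z i ≠ 0 := by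
  intro h
  have hi : dist (z i) (c i) < R := (dist_le_pi_dist z c i).trans_lt hz
  rw [← sub_eq_zero.1 h, dist_torusMap_apply] at hi
  exact (le_abs_self R).not_gt hi

lemma mem_closedBall_fin_succ {α : Type*} [PseudoMetricSpace α] {c z : Fin (n + 1) → α} {R : ℝ}
    (hR : 0 ≤ R) :
    z ∈ closedBall c R ↔
      z 0 ∈ closedBall (c 0) R ∧ z ∘ Fin.succ ∈ closedBall (c ∘ Fin.succ) R := by
  simp [mem_closedBall, dist_pi_le_iff hR, Fin.forall_fin_succ]

lemma mem_ball_comp_succ {α : Type*} [PseudoMetricSpace α] {c z : Fin (n + 1) → α} {R : ℝ}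
    (hz : z ∈ ball c R) : z ∘ Fin.succ ∈ ball (c ∘ Fin.succ) R :=
  (dist_pi_lt_iff (pos_of_mem_ball hz)).2 fun i => (dist_le_pi_dist z c i.succ).trans_lt hz

lemma fin_cons_add_smul_cons {R M : Type*} [AddCommMonoid M] [SMul R M] (x a : M)
    (y v : Fin n → M) (t : R) :
    (Fin.cons x y : Fin (n + 1) → M) + t • Fin.cons a v = Fin.cons (x + t • a) (y + t • v) := by
  ext i
  refine Fin.cases ?_ (fun j => ?_) i <;> simp

lemma lineDifferentiableAt_comp_fin_cons {f : (Fin (n + 1) → ℂ) → E} {x : ℂ} {y v : Fin n → ℂ}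
    (h : LineDifferentiableAt ℂ f (Fin.cons x y) (Fin.cons 0 v)) :
    LineDifferentiableAt ℂ (fun y => f (Fin.cons x y)) y v := by
  simpa only [LineDifferentiableAt, fin_cons_add_smul_cons, smul_zero, add_zero] using h

lemma differentiableAt_comp_fin_cons {f : (Fin (n + 1) → ℂ) → E} {x : ℂ} {y : Fin n → ℂ}
    (h : LineDifferentiableAt ℂ f (Fin.cons x y) (Fin.cons 1 0)) :
    DifferentiableAt ℂ (fun x => f (Fin.cons x y)) x := by
  simp only [LineDifferentiableAt, fin_cons_add_smul_cons, smul_zero, add_zero, smul_eq_mul,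
    mul_one] at h
  rw [← sub_self x] at h
  simpa [Function.comp_def] using
    h.comp (f := fun t => t - x) x (by fun_prop)

lemma torusIntegrable_prod_sub_inv_smul {f : (Fin n → ℂ) → E} {c z : Fin n → ℂ} {R : ℝ}
    (hc : ContinuousOn f (closedBall c R)) (hz : z ∈ ball c R) :
    TorusIntegrable (fun ζ => (∏ i, (ζ i - z i)⁻¹) • f ζ) c (fun _ => R) := by
  refine ContinuousOn.integrableOn_compact isCompact_Icc (Continuous.continuousOn ?_)
  have hT := continuous_torusMap c (fun _ => R)
  refine Continuous.smul (continuous_finsetProd _ fun i _ => ?_)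
    (hc.comp_continuous hT (torusMap_mem_closedBall c (pos_of_mem_ball hz).le))
  exact Continuous.inv₀ (by fun_prop) fun θ => torusMap_sub_ne_zero hz θ i

theorem torusIntegral_prod_sub_inv_smul [CompleteSpace E] {f : (Fin n → ℂ) → E}
    {c z : Fin n → ℂ} {R : ℝ} (hc : ContinuousOn f (closedBall c R))
    (hd : ∀ w ∈ closedBall c R, ∀ v, LineDifferentiableAt ℂ f w v) (hz : z ∈ ball c R) :
    torusIntegral (fun ζ => (∏ i, (ζ i - z i)⁻¹) • f ζ) c (fun _ => R) =
      (2 * Real.pi * Complex.I : ℂ) ^ n • f z := by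
  induction n with
  | zero =>
    rw [torusIntegral_dim0]
    simp [Subsingleton.elim c z]
  | succ n ih =>
    have hR : 0 ≤ R := (pos_of_mem_ball hz).le
    have hz' := mem_ball_comp_succ hz
    have hcons {x : ℂ} (hx : x ∈ closedBall (c 0) R) {y : Fin n → ℂ}
        (hy : y ∈ closedBall (c ∘ Fin.succ) R) :
        (Fin.cons x y : Fin (n + 1) → ℂ) ∈ closedBall c R :=
      (mem_closedBall_fin_succ hR).2 ⟨hx, hy⟩
    have hinner : ∀ x ∈ sphere (c 0) R,
        torusIntegral (fun y : Fin n → ℂ =>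
          (∏ i, ((Fin.cons x y : Fin (n + 1) → ℂ) i - z i)⁻¹) • f (Fin.cons x y))
          (c ∘ Fin.succ) ((fun _ => R) ∘ Fin.succ) =
        (2 * Real.pi * Complex.I : ℂ) ^ n •
          ((x - z 0)⁻¹ • f (Fin.cons x (z ∘ Fin.succ))) := by
      intro x hx
      have hx' := sphere_subset_closedBall hx
      have hxy := ih (f := fun y => f (Fin.cons x y))
        (hc.comp (by fun_prop) fun y hy => hcons hx' hy)
        (fun y hy v => lineDifferentiableAt_comp_fin_cons (hd _ (hcons hx' hy) _)) hz'
      simp only [Fin.prod_univ_succ, Fin.cons_zero, Fin.cons_succ, mul_smul]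
      rw [torusIntegral_smul, smul_comm]
      exact congrArg _ hxy
    have houter : DifferentiableOn ℂ (fun x : ℂ => f (Fin.cons x (z ∘ Fin.succ)))
        (closedBall (c 0) R) := fun x hx =>
      (differentiableAt_comp_fin_cons
        (hd _ (hcons hx (ball_subset_closedBall hz')) _)).differentiableWithinAt
    rw [torusIntegral_succ (torusIntegrable_prod_sub_inv_smul hc hz),
      circleIntegral.integral_congr hR hinner, circleIntegral.integral_smul,
      (houter.diffContOnCl_ball subset_rfl).circleIntegral_sub_inv_smul
        ((dist_le_pi_dist z c 0).trans_lt hz), smul_smul, ← pow_succ]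
    exact congrArg (fun w => _ • f w) (Fin.cons_self_tail z)

end CauchyFormula

section Osgood

open MeasureTheory Metric

variable {E : Type*} [NormedAddCommGroup E] [NormedSpace ℂ E] {n : ℕ}

/-- The parameter box `[0, 2π]ⁿ` of a torus in `ℂⁿ`. -/
abbrev torusBox (n : ℕ) : Set (Fin n → ℝ) := Set.Icc 0 fun _ => 2 * Real.pi

/-- The `i`-th coordinate of `torusMap c R` as a continuous function on the parameter box. -/
noncomputable def torusCoord (c : Fin n → ℂ) (R : ℝ) (i : Fin n) : C(torusBox n, ℂ) :=
  ⟨fun θ => torusMap c (fun _ => R) θ i,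
    by have := continuous_torusMap c (fun _ => R); fun_prop⟩

/-- The Cauchy kernel `∏ᵢ (ζᵢ - zᵢ)⁻¹`, as a map from the polydisc to the Banach space of continuous
functions of the torus variable `ζ`. -/
noncomputable def cauchyKernel (c : Fin n → ℂ) (R : ℝ) (z : Fin n → ℂ) : C(torusBox n, ℂ) :=
  ∏ i, Ring.inverse (torusCoord c R i - algebraMap ℂ _ (z i))

lemma torusCoord_sub_algebraMap_apply (c : Fin n → ℂ) (R : ℝ) (i : Fin n) (a : ℂ)
    (θ : torusBox n) :
    (torusCoord c R i - algebraMap ℂ _ a) θ = torusMap c (fun _ => R) θ i - a := by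
  simp [torusCoord]

lemma isUnit_torusCoord_sub_algebraMap {c z : Fin n → ℂ} {R : ℝ} (hz : z ∈ ball c R) (i : Fin n) :
    IsUnit (torusCoord c R i - algebraMap ℂ _ (z i)) := by
  rw [ContinuousMap.isUnit_iff_forall_ne_zero]
  intro θ
  rw [torusCoord_sub_algebraMap_apply]
  exact torusMap_sub_ne_zero hz θ i

lemma cauchyKernel_apply {c z : Fin n → ℂ} {R : ℝ} (hz : z ∈ ball c R) (θ : torusBox n) :
    cauchyKernel c R z θ = ∏ i, (torusMap c (fun _ => R) θ i - z i)⁻¹ := by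
  rw [cauchyKernel, ContinuousMap.prod_apply]
  refine Finset.prod_congr rfl fun i _ => eq_inv_of_mul_eq_one_right ?_
  have h := DFunLike.congr_fun
    (Ring.mul_inverse_cancel _ (isUnit_torusCoord_sub_algebraMap hz i)) θ
  rwa [ContinuousMap.mul_apply, torusCoord_sub_algebraMap_apply] at h

lemma analyticAt_cauchyKernel {c z : Fin n → ℂ} {R : ℝ} (hz : z ∈ ball c R) :
    AnalyticAt ℂ (cauchyKernel c R) z := by
  refine Finset.analyticAt_fun_prod _ fun i _ => ?_
  obtain ⟨u, hu⟩ := isUnit_torusCoord_sub_algebraMap hz i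
  refine AnalyticAt.fun_comp (g := Ring.inverse) (by rw [← hu]; exact analyticAt_inverse u) ?_
  simp only [Algebra.algebraMap_eq_smul_one]
  exact analyticAt_const.sub
    (((ContinuousLinearMap.proj (R := ℂ) (φ := fun _ : Fin n => ℂ) i).analyticAt z).fun_smul
      analyticAt_const)

/-- The functional `g ↦ ∫ g • h dμ` on the continuous functions on a compact space. -/
noncomputable def integralAgainst {X : Type*} [TopologicalSpace X] [CompactSpace X]
    [MeasurableSpace X] [BorelSpace X] (μ : Measure X) [IsFiniteMeasure μ] (h : C(X, E)) :
    C(X, ℂ) →L[ℂ] E :=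
  have hint (g : C(X, ℂ)) : Integrable (fun x => g x • h x) μ :=
    (g.continuous.smul h.continuous).integrable_of_hasCompactSupport
      (HasCompactSupport.of_compactSpace _)
  LinearMap.mkContinuous
    { toFun := fun g => ∫ x, g x • h x ∂μ
      map_add' := fun g₁ g₂ => by
        simp only [ContinuousMap.add_apply, add_smul]
        exact integral_add (hint g₁) (hint g₂)
      map_smul' := fun a g => by
        simp only [ContinuousMap.smul_apply, smul_assoc, RingHom.id_apply]
        exact integral_smul a _ }
    (‖h‖ * μ.real Set.univ) fun g => by
      refine (norm_integral_le_of_norm_le_const (C := ‖g‖ * ‖h‖) ?_).trans_eq (by ring)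
      refine Filter.Eventually.of_forall fun x => ?_
      rw [norm_smul]
      gcongr
      · exact g.norm_coe_le_norm x
      · exact h.norm_coe_le_norm x

/-- The restriction of `f` to a torus, times the Jacobian of the parametrization by angles. -/
noncomputable def torusDensity (f : (Fin n → ℂ) → E) {c : Fin n → ℂ} {R : ℝ} (hR : 0 ≤ R)
    (hc : ContinuousOn f (closedBall c R)) : C(torusBox n, E) where
  toFun θ := (∏ i : Fin n, (R : ℂ) * Complex.exp (θ.1 i * Complex.I) * Complex.I) •
    f (torusMap c (fun _ => R) θ)
  continuous_toFun := by
    have hθ (i : Fin n) : Continuous fun θ : torusBox n => (θ.1 i : ℂ) :=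
      Complex.continuous_ofReal.comp ((continuous_apply i).comp continuous_subtype_val)
    exact Continuous.smul (continuous_finsetProd _ fun i _ => by fun_prop)
      (hc.comp_continuous ((continuous_torusMap _ _).comp continuous_subtype_val)
        fun θ => torusMap_mem_closedBall c hR θ)

attribute [local instance] Measure.Subtype.measureSpace

instance (n : ℕ) : IsFiniteMeasure (volume : Measure (torusBox n)) :=
  ⟨by
    rw [Measure.Subtype.volume_univ measurableSet_Icc.nullMeasurableSet]
    exact isCompact_Icc.measure_lt_top⟩

/-- **Osgood's lemma** at the centre of a polydisc. -/
theorem analyticAt_of_lineDifferentiableAt_closedBall [CompleteSpace E] {f : (Fin n → ℂ) → E}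
    {c : Fin n → ℂ} {R : ℝ} (hR : 0 < R) (hc : ContinuousOn f (closedBall c R))
    (hd : ∀ z ∈ closedBall c R, ∀ v, LineDifferentiableAt ℂ f z v) : AnalyticAt ℂ f c := by
  let I := integralAgainst volume (torusDensity f hR.le hc)
  have hcauchy : ∀ z ∈ ball c R,
      f z = ((2 * Real.pi * Complex.I : ℂ) ^ n)⁻¹ • I (cauchyKernel c R z) := by
    intro z hz
    rw [eq_inv_smul_iff₀ (pow_ne_zero _ Complex.two_pi_I_ne_zero),
      ← torusIntegral_prod_sub_inv_smul hc hd hz, torusIntegral,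
      ← integral_subtype_comap measurableSet_Icc]
    refine integral_congr_ae (Filter.Eventually.of_forall fun θ => ?_)
    simp only
    rw [cauchyKernel_apply hz, smul_comm]
    rfl
  have hI : AnalyticAt ℂ (fun z => I (cauchyKernel c R z)) c :=
    (I.analyticAt _).comp (analyticAt_cauchyKernel (mem_ball_self hR))
  refine (analyticAt_const (v := ((2 * Real.pi * Complex.I : ℂ) ^ n)⁻¹).smul hI).congr ?_
  filter_upwards [ball_mem_nhds c hR] with z hz using (hcauchy z hz).symm

variable {V : Type*} [NormedAddCommGroup V] [NormedSpace ℂ V] [FiniteDimensional ℂ V]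
  [CompleteSpace E] {U : Set V}

theorem analyticOnNhd_of_lineDifferentiableAt {f : V → E} (hU : IsOpen U) (hc : ContinuousOn f U)
    (hd : ∀ z ∈ U, ∀ v, LineDifferentiableAt ℂ f z v) : AnalyticOnNhd ℂ f U := by
  intro c hcU
  let e : V ≃L[ℂ] (Fin (Module.finrank ℂ V) → ℂ) :=
    (Module.finBasis ℂ V).equivFunL
  have hmem : e.symm ⁻¹' U ∈ 𝓝 (e c) :=
    (hU.preimage e.symm.continuous).mem_nhds (by simpa using hcU)
  obtain ⟨R, hR, hRU⟩ := nhds_basis_closedBall.mem_iff.1 hmem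
  have he : AnalyticAt ℂ (f ∘ e.symm) (e c) :=
    analyticAt_of_lineDifferentiableAt_closedBall hR
      (hc.comp e.symm.continuous.continuousOn fun x hx => hRU hx) fun z hz v => by
        simpa [LineDifferentiableAt] using hd (e.symm z) (hRU hz) (e.symm v)
  simpa [Function.comp_def] using he.comp (e.toContinuousLinearMap.analyticAt c)

theorem analyticOnNhd_of_differentiableOn {f : V → E} (hU : IsOpen U)
    (hf : DifferentiableOn ℂ f U) : AnalyticOnNhd ℂ f U :=
  analyticOnNhd_of_lineDifferentiableAt hU hf.continuousOn fun _ hz _ =>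
    (hf.differentiableAt (hU.mem_nhds hz)).lineDifferentiableAt

theorem differentiableOn_tsum_of_norm_le {f : ℕ → V → E} {u : ℕ → ℝ} (hU : IsOpen U)
    (hu : Summable u) (hf : ∀ k, DifferentiableOn ℂ (f k) U)
    (hb : ∀ k, ∀ z ∈ U, ‖f k z‖ ≤ u k) : DifferentiableOn ℂ (fun z => ∑' k, f k z) U := by
  refine (analyticOnNhd_of_lineDifferentiableAt hU
    (continuousOn_tsum (fun k => (hf k).continuousOn) hu hb) fun z hz v => ?_).differentiableOn
  have hline : IsOpen ((fun t : ℂ => z + t • v) ⁻¹' U) := hU.preimage (by fun_prop)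
  exact (Complex.differentiableOn_tsum_of_summable_norm hu
    (fun k => (hf k).comp (by fun_prop) (Set.mapsTo_preimage _ _)) hline
    fun k t ht => hb k _ ht).differentiableAt (hline.mem_nhds (by simpa using hz))

end Osgood

/-! ### Lie groups of transformations in a finite-dimensional space of maps -/

theorem lieGroup_of_isOpenEmbedding {𝕜 F G : Type*} [NontriviallyNormedField 𝕜]
    [NormedAddCommGroup F] [NormedSpace 𝕜 F] [TopologicalSpace G] [Group G] {k : WithTop ℕ∞}
    {e : G → F} (he : Topology.IsOpenEmbedding e) {μ : F × F → F} (hμ : ContDiff 𝕜 k μ)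
    (hmul : ∀ g h, e (g * h) = μ (e g, e h)) {ι : F → F} (hι : ∀ g, ContDiffAt 𝕜 k ι (e g))
    (hinv : ∀ g, e g⁻¹ = ι (e g)) :
    letI := he.singletonChartedSpace
    LieGroup 𝓘(𝕜, F) k G := by
  let := he.singletonChartedSpace
  have hman : IsManifold 𝓘(𝕜, F) k G := he.isManifold_singleton
  have hsm : ContMDiff 𝓘(𝕜, F) 𝓘(𝕜, F) k e := contMDiff_isOpenEmbedding he
  refine { hman with
    contMDiff_mul := .of_comp_isOpenEmbedding he ?_
    contMDiff_inv := .of_comp_isOpenEmbedding he ?_ }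
  · have h := hμ.contMDiff.comp
      ((hsm.comp (contMDiff_fst (N := G))).prodMk_space (hsm.comp contMDiff_snd))
    exact h.congr fun p => hmul p.1 p.2
  · exact ContMDiff.congr (fun g => (hι g).contMDiffAt.comp g (hsm g)) hinv

section CompositionMonoid

variable {𝕜 E : Type*} [RCLike 𝕜] [NormedAddCommGroup E] [NormedSpace 𝕜 E]

/-- A finite-dimensional vector space of analytic self-maps of `E` that contains the identity and is
closed under composition. -/
structure IsCompositionMonoid (V : Submodule 𝕜 (E → E)) : Prop where
  finiteDimensional : FiniteDimensional 𝕜 V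
  id_mem : id ∈ V
  comp_mem : ∀ P ∈ V, ∀ Q ∈ V, P ∘ Q ∈ V
  contDiff : ∀ P ∈ V, ContDiff 𝕜 ω P

namespace IsCompositionMonoid

variable {V : Submodule 𝕜 (E → E)}

/-- Composition on the right with an element of `V`, as a linear endomorphism of `V`. -/
def compRight (hV : IsCompositionMonoid V) (Q : V) : V →ₗ[𝕜] V where
  toFun P := ⟨(P : E → E) ∘ Q, hV.comp_mem _ P.2 _ Q.2⟩
  map_add' _ _ := rfl
  map_smul' _ _ := rfl

lemma exists_perm (hV : IsCompositionMonoid V) {Q : E → E} (hQ : Q ∈ V)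
    (hinj : ∀ A ∈ V, (∀ z, A (Q z) = 0) → A = 0) :
    ∃ g : Equiv.Perm E, (g : E → E) = Q ∧ (g.symm : E → E) ∈ V := by
  have := hV.finiteDimensional
  have hi : Function.Injective (hV.compRight ⟨Q, hQ⟩) := by
    rw [← LinearMap.ker_eq_bot, LinearMap.ker_eq_bot']
    intro A hA
    exact Subtype.ext (hinj A A.2 fun z => congrFun (congrArg Subtype.val hA) z)
  obtain ⟨P, hP⟩ := LinearMap.injective_iff_surjective.1 hi ⟨id, hV.id_mem⟩
  have hPQ : ∀ z, (P : E → E) (Q z) = z := congrFun (congrArg Subtype.val hP)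
  have hQP : Q ∘ (P : E → E) - id = 0 :=
    hinj _ (V.sub_mem (hV.comp_mem _ hQ _ P.2) hV.id_mem) fun z => by simp [hPQ]
  exact ⟨⟨Q, P, hPQ, fun z => sub_eq_zero.1 (congrFun hQP z)⟩, rfl, P.2⟩

lemma symm_mem (hV : IsCompositionMonoid V) {g : Equiv.Perm E} (hg : (g : E → E) ∈ V) :
    (g.symm : E → E) ∈ V := by
  obtain ⟨g', h, h'⟩ := hV.exists_perm hg fun A _ hA => funext fun z => by
    simpa using hA (g.symm z)
  rwa [← DFunLike.coe_injective h]

/-- The group of bijections that belong to `V`. -/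
def permGroup (hV : IsCompositionMonoid V) : Subgroup (Equiv.Perm E) where
  carrier := {g | (g : E → E) ∈ V}
  mul_mem' hg hh := hV.comp_mem _ hg _ hh
  one_mem' := hV.id_mem
  inv_mem' hg := hV.symm_mem hg

variable (hV : IsCompositionMonoid V) {F : Type*} [NormedAddCommGroup F] [NormedSpace 𝕜 F]
  (κ : F ≃ₗ[𝕜] V)

/-- The coordinates of an element of the group. -/
def coord (g : hV.permGroup) : F :=
  κ.symm ⟨(g : Equiv.Perm E), g.2⟩

lemma apply_coord (g : hV.permGroup) : (κ (hV.coord κ g) : E → E) = (g : Equiv.Perm E) := by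
  simp [coord]

lemma coord_injective : Function.Injective (hV.coord κ) := fun _ _ h =>
  Subtype.ext (DFunLike.coe_injective (congrArg Subtype.val (κ.symm.injective h)))

variable [FiniteDimensional 𝕜 F]

include hV in
lemma contDiff_eval : ContDiff 𝕜 ω fun p : F × E => (κ p.1 : E → E) p.2 := by
  let b := Module.finBasis 𝕜 F
  have hb (p : F × E) :
      (κ p.1 : E → E) p.2 = ∑ j, b.equivFunL p.1 j • (κ (b j) : E → E) p.2 := by
    have hp : κ p.1 = ∑ j, b.equivFunL p.1 j • κ (b j) := by
      simp_rw [← map_smul, ← map_sum]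
      exact congrArg κ (b.sum_equivFun p.1).symm
    simp [hp]
  simp only [hb]
  refine ContDiff.sum fun j _ => ContDiff.fun_smul ?_ ?_
  · exact contDiff_pi.1 (b.equivFunL.contDiff.comp contDiff_fst) j
  · exact (hV.contDiff _ (κ (b j)).2).comp contDiff_snd

lemma span_evalFunctional (V : Submodule 𝕜 (E → E)) [FiniteDimensional 𝕜 V] :
    Submodule.span 𝕜 (Set.range fun p : E × (E →L[𝕜] 𝕜) =>
      ((p.2 : E →ₗ[𝕜] 𝕜) ∘ₗ LinearMap.proj p.1 ∘ₗ V.subtype : Module.Dual 𝕜 V)) = ⊤ := by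
  refine Submodule.span_eq_top_of_ne_zero fun P hP => ?_
  contrapose! hP
  refine Subtype.ext (funext fun z =>
    SeparatingDual.eq_zero_of_forall_dual_eq_zero (R := 𝕜) fun ℓ => ?_)
  exact hP _ ⟨(z, ℓ), rfl⟩

lemma contDiff_symm_compRight :
    ContDiff 𝕜 ω fun p : F × F => κ.symm (hV.compRight (κ p.2) (κ p.1)) := by
  have := hV.finiteDimensional
  have hdual (ℓ : Module.Dual 𝕜 V) :
      ContDiff 𝕜 ω fun p : F × F => ℓ (hV.compRight (κ p.2) (κ p.1)) := by
    have hℓ : ℓ ∈ (⊤ : Submodule 𝕜 (Module.Dual 𝕜 V)) := trivial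
    rw [← span_evalFunctional] at hℓ
    induction hℓ using Submodule.span_induction with
    | mem ℓ h =>
      obtain ⟨⟨z, ξ⟩, rfl⟩ := h
      have heval : ContDiff 𝕜 ω fun p : F × F => (κ p.1 : E → E) ((κ p.2 : E → E) z) :=
        (hV.contDiff_eval κ).comp (contDiff_fst.prodMk
          ((hV.contDiff_eval κ).comp (contDiff_snd.prodMk contDiff_const)))
      exact ξ.contDiff.comp heval
    | zero => exact contDiff_const
    | add ℓ₁ ℓ₂ _ _ h₁ h₂ => exact h₁.add h₂
    | smul a ℓ _ h => exact contDiff_const.smul h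
  let b := (Module.finBasis 𝕜 F).equivFunL
  rw [← b.comp_contDiff_iff, contDiff_pi]
  exact fun j => hdual (LinearMap.proj j ∘ₗ b.toLinearEquiv.toLinearMap ∘ₗ κ.symm.toLinearMap)

/-- Composition on the right, in the coordinates `κ`. -/
noncomputable def rightOp (x : F) : F →L[𝕜] F :=
  LinearMap.toContinuousLinearMap (κ.symm.toLinearMap ∘ₗ hV.compRight (κ x) ∘ₗ κ.toLinearMap)

lemma rightOp_apply (x y : F) : hV.rightOp κ x y = κ.symm (hV.compRight (κ x) (κ y)) := rfl

lemma contDiff_rightOp : ContDiff 𝕜 ω (hV.rightOp κ) :=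
  contDiff_clm_apply_iff.2 fun _ =>
    (hV.contDiff_symm_compRight κ).comp (contDiff_const.prodMk contDiff_id)

lemma apply_rightOp_coord (g : hV.permGroup) (y : F) :
    (κ (hV.rightOp κ (hV.coord κ g) y) : E → E) = κ y ∘ (g : Equiv.Perm E) := by
  rw [rightOp_apply, LinearEquiv.apply_symm_apply, ← apply_coord hV κ g]
  rfl

lemma coord_mul (g h : hV.permGroup) :
    hV.coord κ (g * h) = hV.rightOp κ (hV.coord κ h) (hV.coord κ g) := by
  apply κ.injective
  apply Subtype.ext
  rw [apply_rightOp_coord, apply_coord, apply_coord]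
  rfl

lemma rightOp_coord_mul (g h : hV.permGroup) :
    hV.rightOp κ (hV.coord κ (g * h)) =
      hV.rightOp κ (hV.coord κ h) * hV.rightOp κ (hV.coord κ g) := by
  ext1 y
  apply κ.injective
  apply Subtype.ext
  rw [mul_apply_eq_comp, apply_rightOp_coord, apply_rightOp_coord, apply_rightOp_coord]
  rfl

lemma rightOp_coord_one : hV.rightOp κ (hV.coord κ 1) = 1 := by
  ext1 y
  apply κ.injective
  apply Subtype.ext
  rw [apply_rightOp_coord]
  rfl

/-- Composition on the right with a group element, as a unit. -/
noncomputable def rightOpUnit (g : hV.permGroup) : (F →L[𝕜] F)ˣ where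
  val := hV.rightOp κ (hV.coord κ g)
  inv := hV.rightOp κ (hV.coord κ g⁻¹)
  val_inv := by rw [← rightOp_coord_mul, inv_mul_cancel, rightOp_coord_one]
  inv_val := by rw [← rightOp_coord_mul, mul_inv_cancel, rightOp_coord_one]

lemma range_coord : Set.range (hV.coord κ) = {x | IsUnit (hV.rightOp κ x)} := by
  ext x
  refine ⟨fun ⟨g, hg⟩ => hg ▸ ⟨hV.rightOpUnit κ g, rfl⟩, fun hx => ?_⟩
  have hinj : Function.Injective (hV.rightOp κ x) :=
    ((Module.End.isUnit_iff _).1 (hx.map (ContinuousLinearMap.toLinearMapRingHom))).injective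
  obtain ⟨g, hg, -⟩ := hV.exists_perm (κ x).2 fun A hA hAx => by
    have hker : hV.rightOp κ x (κ.symm ⟨A, hA⟩) = hV.rightOp κ x 0 := by
      rw [map_zero, rightOp_apply, LinearEquiv.map_eq_zero_iff, LinearEquiv.apply_symm_apply]
      exact Subtype.ext (funext hAx)
    exact congrArg Subtype.val (κ.symm.map_eq_zero_iff.1 (hinj hker))
  refine ⟨⟨g, show (g : E → E) ∈ V from hg ▸ (κ x).2⟩, κ.injective (Subtype.ext ?_)⟩
  rw [apply_coord]
  exact hg

lemma contDiffAt_inverse_rightOp_coord (g : hV.permGroup) :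
    ContDiffAt 𝕜 ω (fun x => Ring.inverse (hV.rightOp κ x) (hV.coord κ 1)) (hV.coord κ g) := by
  have := FiniteDimensional.complete 𝕜 F
  have hunit : ContDiffAt 𝕜 ω Ring.inverse (hV.rightOp κ (hV.coord κ g)) :=
    contDiffAt_ringInverse 𝕜 (hV.rightOpUnit κ g)
  exact (hunit.comp _ (hV.contDiff_rightOp κ).contDiffAt).clm_apply contDiffAt_const

lemma coord_inv (g : hV.permGroup) :
    hV.coord κ g⁻¹ = Ring.inverse (hV.rightOp κ (hV.coord κ g)) (hV.coord κ 1) := by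
  have hinv : Ring.inverse (hV.rightOp κ (hV.coord κ g)) = hV.rightOp κ (hV.coord κ g⁻¹) :=
    Ring.inverse_unit (hV.rightOpUnit κ g)
  rw [hinv, ← coord_mul, one_mul]

theorem exists_lieGroup (hF : Module.finrank 𝕜 F = Module.finrank 𝕜 V) :
    ∃ (_ : TopologicalSpace hV.permGroup) (_ : ChartedSpace F hV.permGroup),
      T2Space hV.permGroup ∧ SecondCountableTopology hV.permGroup ∧
      LieGroup 𝓘(𝕜, F) ω hV.permGroup ∧
      ContMDiff (𝓘(𝕜, F).prod 𝓘(𝕜, E)) 𝓘(𝕜, E) ω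
        (fun p : hV.permGroup × E => (p.1 : Equiv.Perm E) p.2) := by
  have := FiniteDimensional.complete 𝕜 F
  have := FiniteDimensional.proper_rclike 𝕜 F
  have := hV.finiteDimensional
  let κ : F ≃ₗ[𝕜] V := LinearEquiv.ofFinrankEq F V hF
  let := TopologicalSpace.induced (hV.coord κ) inferInstance
  have hemb : Topology.IsOpenEmbedding (hV.coord κ) :=
    ⟨⟨⟨rfl⟩, hV.coord_injective κ⟩, by
      rw [range_coord]; exact Units.isOpen.preimage (hV.contDiff_rightOp κ).continuous⟩
  let := hemb.singletonChartedSpace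
  refine ⟨‹_›, ‹_›, hemb.isEmbedding.t2Space, hemb.isEmbedding.secondCountableTopology, ?_, ?_⟩
  · exact lieGroup_of_isOpenEmbedding hemb (hV.contDiff_symm_compRight κ) (hV.coord_mul κ)
      (hV.contDiffAt_inverse_rightOp_coord κ) (hV.coord_inv κ)
  · have hsm : ContMDiff 𝓘(𝕜, F) 𝓘(𝕜, F) ω (hV.coord κ) := contMDiff_isOpenEmbedding hemb
    refine ((hV.contDiff_eval κ).contMDiff.comp
      ((hsm.comp contMDiff_fst).prodMk_space contMDiff_snd)).congr fun p => ?_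
    exact (congrFun (hV.apply_coord κ p.1) p.2).symm

end IsCompositionMonoid

end CompositionMonoid

/-! ### Polynomial functions and polynomials of bounded weight -/

section PolynomialFunctions

variable {R V ι : Type*} [CommRing R] [AddCommGroup V] [Module R V]

variable (R V) in
/-- The polynomial functions on a module: the algebra generated by the linear functionals. -/
def polyFunctions : Subalgebra R (V → R) :=
  Algebra.adjoin R (Set.range ((⇑) : Module.Dual R V → V → R))

lemma dual_eq_sum_smul_coord [Fintype ι] (b : Module.Basis ι R V) (φ : Module.Dual R V) :
    ⇑φ = ∑ i, φ (b i) • ⇑(b.coord i) := by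
  funext z
  conv_lhs => rw [← b.sum_repr z, map_sum]
  simp [mul_comm]

lemma mem_polyFunctions_iff [Finite ι] (b : Module.Basis ι R V) {f : V → R} :
    f ∈ polyFunctions R V ↔
      ∃ p : MvPolynomial ι R, ∀ z, f z = MvPolynomial.eval (b.repr z) p := by
  have := Fintype.ofFinite ι
  have hcoord (p : MvPolynomial ι R) (z : V) :
      MvPolynomial.aeval (fun i => ⇑(b.coord i)) p z = MvPolynomial.eval (b.repr z) p := by
    induction p using MvPolynomial.induction_on with
    | C a => simp
    | add p q hp hq => simp [hp, hq]
    | mul_X p i hp => simp [hp]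
  have hrange : polyFunctions R V =
      (MvPolynomial.aeval (R := R) fun i => ⇑(b.coord i)).range := by
    rw [← Algebra.adjoin_range_eq_range_aeval]
    refine le_antisymm (Algebra.adjoin_le ?_) (Algebra.adjoin_mono ?_)
    · rintro _ ⟨φ, rfl⟩
      rw [dual_eq_sum_smul_coord b]
      exact Subalgebra.sum_mem _ fun i _ => Subalgebra.smul_mem _
        (Algebra.subset_adjoin (Set.mem_range_self i)) _
    · rintro _ ⟨i, rfl⟩
      exact ⟨b.coord i, rfl⟩
  rw [hrange, AlgHom.mem_range]
  simp only [funext_iff, hcoord, eq_comm]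

lemma isPolynomialMap_iff {n : ℕ} {P : Cn n → Cn n} :
    IsPolynomialMap P ↔
      ∀ φ : Module.Dual ℂ (Cn n), ⇑φ ∘ P ∈ polyFunctions ℂ (Cn n) := by
  let e := (EuclideanSpace.basisFun (Fin n) ℂ).toBasis
  have hP (i : Fin n) : (∃ p : MvPolynomial (Fin n) ℂ, ∀ z, P z i =
      MvPolynomial.eval (fun k => z k) p) ↔
      ⇑(e.coord i) ∘ P ∈ polyFunctions ℂ (Cn n) := (mem_polyFunctions_iff e).symm
  refine (forall_congr' hP).trans ⟨fun h φ => ?_, fun h i => h _⟩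
  have hφ : ⇑φ ∘ P = ∑ i, φ (e i) • (⇑(e.coord i) ∘ P) := by
    funext z
    simpa using congrFun (dual_eq_sum_smul_coord e φ) (P z)
  rw [hφ]
  exact Subalgebra.sum_mem _ fun i _ => Subalgebra.smul_mem _ (h i) _

lemma contDiff_of_mem_polyFunctions {𝕜 V : Type*} [RCLike 𝕜]
    [NormedAddCommGroup V] [NormedSpace 𝕜 V] [FiniteDimensional 𝕜 V] {f : V → 𝕜}
    (hf : f ∈ polyFunctions 𝕜 V) {k : WithTop ℕ∞} : ContDiff 𝕜 k f := by
  induction hf using Algebra.adjoin_induction with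
  | mem f h =>
    obtain ⟨φ, rfl⟩ := h
    exact (LinearMap.toContinuousLinearMap φ).contDiff
  | algebraMap a => exact contDiff_const
  | add f g _ _ hf hg => exact hf.add hg
  | mul f g _ _ hf hg => exact hf.mul hg

end PolynomialFunctions

section BoundedWeight

open MvPolynomial

variable {ι R : Type*} [CommSemiring R] (w : ι → ℝ)

variable (R) in
/-- The polynomials all of whose monomials have weight at most `c`, when the variable `k` has weight
`w k`. -/
noncomputable def boundedWeight (c : ℝ) : Submodule R (MvPolynomial ι R) :=
  restrictSupport R {α | Finsupp.weight w α ≤ c}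

variable {w}

lemma boundedWeight_mono {c d : ℝ} (h : c ≤ d) : boundedWeight R w c ≤ boundedWeight R w d :=
  fun _ hp _ hα => (hp hα).trans h

lemma X_mem_boundedWeight (k : ι) : X k ∈ boundedWeight R w (w k) :=
  (monomial_mem_restrictSupport R).2 (Or.inl (by simp [Finsupp.weight_apply]))

lemma C_mem_boundedWeight {c : ℝ} (hc : 0 ≤ c) (a : R) : C a ∈ boundedWeight R w c :=
  (monomial_mem_restrictSupport R).2 (Or.inl (by simpa using hc))

lemma mul_mem_boundedWeight {c d : ℝ} {p q : MvPolynomial ι R} (hp : p ∈ boundedWeight R w c)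
    (hq : q ∈ boundedWeight R w d) : p * q ∈ boundedWeight R w (c + d) := by
  classical
  intro α hα
  obtain ⟨β, hβ, γ, hγ, rfl⟩ := Finset.mem_add.1 (support_mul p q hα)
  simpa only [Set.mem_ofPred_eq, map_add] using add_le_add (hp hβ) (hq hγ)

lemma prod_mem_boundedWeight {κ : Type*} {s : Finset κ} {c : κ → ℝ} {p : κ → MvPolynomial ι R}
    (hp : ∀ k ∈ s, p k ∈ boundedWeight R w (c k)) :
    ∏ k ∈ s, p k ∈ boundedWeight R w (∑ k ∈ s, c k) := by
  classical
  induction s using Finset.induction_on with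
  | empty => simpa using C_mem_boundedWeight (w := w) le_rfl (1 : R)
  | insert k s hk ih =>
    rw [Finset.prod_insert hk, Finset.sum_insert hk]
    exact mul_mem_boundedWeight (hp k (by simp)) (ih fun j hj => hp j (by simp [hj]))

lemma pow_mem_boundedWeight {c : ℝ} {p : MvPolynomial ι R} (hp : p ∈ boundedWeight R w c)
    (m : ℕ) : p ^ m ∈ boundedWeight R w (m • c) := by
  simpa using prod_mem_boundedWeight (s := Finset.range m) fun _ _ => hp

lemma bind₁_mem_boundedWeight {κ : Type*} {v : κ → ℝ} {c : ℝ} {p : MvPolynomial κ R}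
    (hp : p ∈ boundedWeight R v c) {q : κ → MvPolynomial ι R}
    (hq : ∀ k, q k ∈ boundedWeight R w (v k)) : bind₁ q p ∈ boundedWeight R w c := by
  rw [p.as_sum, map_sum]
  refine Submodule.sum_mem _ fun α hα => ?_
  rw [bind₁_monomial, ← smul_eq_C_mul]
  refine Submodule.smul_mem _ _ (boundedWeight_mono ?_
    (prod_mem_boundedWeight fun k _ => pow_mem_boundedWeight (hq k) (α k)))
  exact hp hα

lemma finite_setOf_weight_le [Finite ι] (hw : ∀ k, 0 < w k) (c : ℝ) :
    {α : ι →₀ ℕ | Finsupp.weight w α ≤ c}.Finite := by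
  classical
  have := Fintype.ofFinite ι
  refine ((Set.finite_Iic fun k => ⌊c / w k⌋₊).preimage
    (DFunLike.coe_injective (F := ι →₀ ℕ)).injOn).subset fun α hα k => ?_
  refine Nat.le_floor ((le_div_iff₀ (hw k)).2 (le_trans ?_ hα))
  rw [Finsupp.weight_apply, Finsupp.sum_fintype _ _ (by simp)]
  simpa using Finset.single_le_sum (f := fun k => α k • w k)
    (fun j _ => nsmul_nonneg (hw j).le _) (Finset.mem_univ k)

lemma finite_boundedWeight [Finite ι] (hw : ∀ k, 0 < w k) (c : ℝ) :
    Module.Finite R (boundedWeight R w c) := by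
  have := (finite_setOf_weight_le hw c).to_subtype
  exact Module.Finite.of_basis (basisRestrictSupport R _)

lemma coeff_bind₁_C_mul_X (a : ι → R) (p : MvPolynomial ι R) (α : ι →₀ ℕ) :
    coeff α (bind₁ (fun k => C (a k) * X k) p) = (α.prod fun k m => a k ^ m) * coeff α p := by
  classical
  induction p using MvPolynomial.induction_on' with
  | monomial β c =>
    have hmono : bind₁ (fun k => C (a k) * X k) (monomial β c) =
        monomial β ((β.prod fun k m => a k ^ m) * c) := by
      rw [bind₁_monomial, mul_comm _ c, monomial_eq, map_mul, mul_assoc]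
      simp only [Finsupp.prod, mul_pow, Finset.prod_mul_distrib, map_pow, map_prod]
    rw [hmono]
    simp only [coeff_monomial]
    split_ifs with h
    · rw [h]
    · simp
  | add p q hp hq => rw [map_add, coeff_add, coeff_add, hp, hq, mul_add]

end BoundedWeight

section WeightedMaps

variable {ι 𝕜 V : Type*} [RCLike 𝕜] [NormedAddCommGroup V] [NormedSpace 𝕜 V]

/-- The polynomial maps whose `i`-th coordinate with respect to `b` has weight at most `w i`. -/
noncomputable def weightedMaps (b : Module.Basis ι 𝕜 V) (w : ι → ℝ) : Submodule 𝕜 (V → V) where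
  carrier := {P | ∀ i, ∃ p ∈ boundedWeight 𝕜 w (w i),
    ∀ z, b.repr (P z) i = MvPolynomial.eval (b.repr z) p}
  zero_mem' i := ⟨0, Submodule.zero_mem _, by simp⟩
  add_mem' {P Q} hP hQ i := by
    obtain ⟨p, hp, hPp⟩ := hP i
    obtain ⟨q, hq, hQq⟩ := hQ i
    exact ⟨p + q, Submodule.add_mem _ hp hq, by simp [hPp, hQq]⟩
  smul_mem' a P hP i := by
    obtain ⟨p, hp, hPp⟩ := hP i
    exact ⟨a • p, Submodule.smul_mem _ a hp, by simp [hPp, MvPolynomial.smul_eval]⟩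

variable {b : Module.Basis ι 𝕜 V} {w : ι → ℝ}

lemma const_mem_weightedMaps (hw : ∀ k, 0 < w k) (τ : V) :
    (fun _ => τ) ∈ weightedMaps b w := fun i =>
  ⟨MvPolynomial.C (b.repr τ i), C_mem_boundedWeight (hw i).le _, by simp⟩

variable [Finite ι]

lemma finiteDimensional_weightedMaps (hw : ∀ k, 0 < w k) :
    FiniteDimensional 𝕜 (weightedMaps b w) := by
  have := Fintype.ofFinite ι
  have (i : ι) : Module.Finite 𝕜 (boundedWeight 𝕜 w (w i)) := finite_boundedWeight hw (w i)
  let Ψ : (∀ i, boundedWeight 𝕜 w (w i)) →ₗ[𝕜] (V → V) :=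
    { toFun := fun p z => ∑ i, MvPolynomial.eval (b.repr z) (p i).1 • b i
      map_add' := fun p q => by
        funext z
        simp [add_smul, Finset.sum_add_distrib]
      map_smul' := fun a p => by
        funext z
        simp [MvPolynomial.smul_eval, mul_smul, Finset.smul_sum] }
  refine Submodule.finiteDimensional_of_le (S₂ := LinearMap.range Ψ) fun P hP => ?_
  choose p hp hPp using hP
  refine ⟨fun i => ⟨p i, hp i⟩, funext fun z => ?_⟩
  simp [Ψ, ← hPp, b.sum_repr]

lemma isCompositionMonoid_weightedMaps (hw : ∀ k, 0 < w k) :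
    IsCompositionMonoid (weightedMaps b w) where
  finiteDimensional := finiteDimensional_weightedMaps hw
  id_mem i := ⟨MvPolynomial.X i, X_mem_boundedWeight i, by simp⟩
  comp_mem P hP Q hQ := by
    choose q hq hQq using hQ
    intro i
    obtain ⟨p, hp, hPp⟩ := hP i
    refine ⟨MvPolynomial.bind₁ q p, bind₁_mem_boundedWeight hp hq, fun z => ?_⟩
    simp only [MvPolynomial.eval, MvPolynomial.eval₂Hom_bind₁] at hQq hPp ⊢
    simp only [Function.comp_apply, hPp, ← hQq]
  contDiff P hP := by
    have := Fintype.ofFinite ι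
    have := Module.Finite.of_basis b
    have hsum : P = fun z => ∑ i, b.repr (P z) i • b i := funext fun z => (b.sum_repr _).symm
    rw [hsum]
    refine ContDiff.sum fun i _ => ContDiff.fun_smul ?_ contDiff_const
    obtain ⟨p, -, hp⟩ := hP i
    exact contDiff_of_mem_polyFunctions ((mem_polyFunctions_iff b).2 ⟨p, hp⟩)

end WeightedMaps

/-! ### Bases adapted to the generalized eigenspaces -/

/-- A basis of generalized eigenvectors of `L`, compatible with the decomposition into generalized
eigenspaces. -/
structure AdaptedBasis {K V : Type*} [Field K] [AddCommGroup V] [Module K V]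
    (L : Module.End K V) (ι : Type*) where
  basis : Module.Basis ι K V
  ev : ι → L.Eigenvalues
  basis_mem : ∀ k, basis k ∈ L.maxGenEigenspace (ev k : K)
  repr_eq_zero : ∀ {j : L.Eigenvalues} {t : V}, t ∈ L.maxGenEigenspace (j : K) →
    ∀ {k}, ev k ≠ j → basis.repr t k = 0

lemma isInternal_maxGenEigenspace {K V : Type*} [Field K] [IsAlgClosed K] [AddCommGroup V]
    [Module K V] [FiniteDimensional K V] [DecidableEq K] (L : Module.End K V) :
    DirectSum.IsInternal fun j : L.Eigenvalues => L.maxGenEigenspace (j : K) := by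
  refine DirectSum.isInternal_submodule_of_iSupIndep_of_iSup_eq_top
    (L.independent_maxGenEigenspace.comp Subtype.val_injective) ?_
  rw [eq_top_iff, ← L.iSup_maxGenEigenspace_eq_top]
  refine iSup_le fun μ => ?_
  by_cases h : L.maxGenEigenspace μ = ⊥
  · exact h ▸ bot_le
  · have hμ : L.HasUnifEigenvalue μ ⊤ := h
    exact le_iSup (fun j : L.Eigenvalues => L.maxGenEigenspace (j : K)) ⟨μ, hμ.lt zero_lt_one⟩

lemma exists_adaptedBasis {K V : Type*} [Field K] [IsAlgClosed K] [AddCommGroup V] [Module K V]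
    [FiniteDimensional K V] (L : Module.End K V) :
    Nonempty (AdaptedBasis L (Fin (Module.finrank K V))) := by
  classical
  have hint := isInternal_maxGenEigenspace L
  let b := hint.collectedBasis fun j => Module.finBasis K _
  let e := b.indexEquiv (Module.finBasis K V)
  refine ⟨⟨b.reindex e, fun k => (e.symm k).1, fun k => ?_, fun {j t} ht k hk => ?_⟩⟩
  · rw [Module.Basis.reindex_apply]
    exact hint.collectedBasis_mem _ _
  · rw [Module.Basis.repr_reindex_apply]
    exact hint.collectedBasis_repr_of_mem_ne _ (Ne.symm hk) ht

namespace AdaptedBasis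

section Field

variable {K V ι : Type*} [Field K] [AddCommGroup V] [Module K V] [FiniteDimensional K V]
  {L : Module.End K V} (b : AdaptedBasis L ι)

lemma repr_sum {t : L.Eigenvalues → V} (ht : ∀ j : L.Eigenvalues, t j ∈ L.maxGenEigenspace (j : K))
    (k : ι) : b.basis.repr (∑ j, t j) k = b.basis.repr (t (b.ev k)) k := by
  rw [map_sum, Finsupp.finsetSum_apply]
  exact Finset.sum_eq_single _ (fun j _ hj => b.repr_eq_zero (ht j) hj.symm) (by simp)

lemma repr_sum_smul {t : L.Eigenvalues → V}
    (ht : ∀ j : L.Eigenvalues, t j ∈ L.maxGenEigenspace (j : K)) (a : L.Eigenvalues → K) (k : ι) :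
    b.basis.repr (∑ j, a j • t j) k = a (b.ev k) * b.basis.repr (∑ j, t j) k := by
  rw [b.repr_sum ht, b.repr_sum fun j => Submodule.smul_mem _ (a j) (ht j), map_smul,
    Finsupp.smul_apply, smul_eq_mul]

lemma exists_mem_repr_sum_eq [Finite ι] (x : ι → K) :
    ∃ t : L.Eigenvalues → V, (∀ j : L.Eigenvalues, t j ∈ L.maxGenEigenspace (j : K)) ∧
      ⇑(b.basis.repr (∑ j, t j)) = x := by
  classical
  have := Fintype.ofFinite ι
  refine ⟨fun j => ∑ m with b.ev m = j, x m • b.basis m, fun j => ?_, ?_⟩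
  · refine Submodule.sum_mem _ fun m hm => Submodule.smul_mem _ _ ?_
    rw [← (Finset.mem_filter.1 hm).2]
    exact b.basis_mem m
  · rw [Finset.sum_fiberwise Finset.univ b.ev fun m => x m • b.basis m, b.basis.repr_sum_self]

lemma prod_comp_ev (a : L.Eigenvalues → K) (α : ι →₀ ℕ) :
    (α.prod fun k m => a (b.ev k) ^ m) = ∏ j, a j ^ α.mapDomain b.ev j := by
  rw [← Finsupp.prod_fintype (α.mapDomain b.ev) (fun j m => a j ^ m) fun j => pow_zero _]
  exact (Finsupp.prod_mapDomain_index (fun _ => pow_zero _) fun _ _ _ => pow_add _ _ _).symm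

end Field

section Weight

variable {K V ι : Type*} [NormedField K] [AddCommGroup V] [Module K V] {L : Module.End K V}
  (b : AdaptedBasis L ι)

/-- The weight `-ln |λ|` of a coordinate along a generalized eigenvector for `λ`. With these weights
sub-resonance of a monomial says that its weight is at most that of its target coordinate. -/
noncomputable def weight (k : ι) : ℝ := -Real.log ‖(b.ev k : K)‖

lemma weight_pos (h0 : ∀ j : L.Eigenvalues, (j : K) ≠ 0)
    (h1 : ∀ j : L.Eigenvalues, ‖(j : K)‖ < 1) (k : ι) : 0 < b.weight k :=
  neg_pos.2 (Real.log_neg (norm_pos_iff.2 (h0 _)) (h1 _))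

lemma weight_eq_neg_sum [FiniteDimensional K V] (α : ι →₀ ℕ) :
    Finsupp.weight b.weight α =
      -∑ j : L.Eigenvalues, (α.mapDomain b.ev j : ℝ) * Real.log ‖(j : K)‖ := by
  rw [← Finsupp.sum_fintype (α.mapDomain b.ev) (fun j m => (m : ℝ) * Real.log ‖(j : K)‖)
      fun j => by simp, Finsupp.sum_mapDomain_index (by simp) (by simp [add_mul]),
    Finsupp.weight_apply, Finsupp.sum, Finsupp.sum, ← Finset.sum_neg_distrib]
  simp [weight]

end Weight

end AdaptedBasis

/-! ### The sub-resonant transformation group -/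

section SubResonant

open MvPolynomial

variable {n : ℕ} {L : Module.End ℂ (Cn n)} {ι : Type*} [Finite ι] {b : AdaptedBasis L ι}

lemma bind₁_C_mul_X_of_isOfType {s : L.Eigenvalues → ℕ} {Q : Cn n → Cn n} (hQ : IsOfType L s Q)
    {k : ι} {p : MvPolynomial ι ℂ} (hp : ∀ z, b.basis.repr (Q z) k = eval (b.basis.repr z) p)
    (a : L.Eigenvalues → ℂ) :
    bind₁ (fun m => C (a (b.ev m)) * X m) p = C (∏ j, a j ^ s j) * p := by
  refine MvPolynomial.funext fun x => ?_
  obtain ⟨t, ht, hx⟩ := b.exists_mem_repr_sum_eq x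
  have hax : (fun m => eval x (C (a (b.ev m)) * X m)) = b.basis.repr (∑ j, a j • t j) := by
    funext m
    rw [b.repr_sum_smul ht, hx, map_mul, eval_C, eval_X]
  calc eval x (bind₁ (fun m => C (a (b.ev m)) * X m) p)
      = eval (fun m => eval x (C (a (b.ev m)) * X m)) p := eval₂Hom_bind₁ _ _ _ _
    _ = b.basis.repr ((∏ j, a j ^ s j) • Q (∑ j, t j)) k := by rw [hax, ← hp, hQ a t ht]
    _ = eval x (C (∏ j, a j ^ s j) * p) := by
        rw [map_smul, Finsupp.smul_apply, hp, hx, map_mul, eval_C, smul_eq_mul]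

lemma mapDomain_ev_eq_of_isOfType {s : L.Eigenvalues → ℕ} {Q : Cn n → Cn n} (hQ : IsOfType L s Q)
    {k : ι} {p : MvPolynomial ι ℂ} (hp : ∀ z, b.basis.repr (Q z) k = eval (b.basis.repr z) p)
    {α : ι →₀ ℕ} (hα : α ∈ p.support) : ⇑(α.mapDomain b.ev) = s := by
  classical
  funext j
  have hprod (a : L.Eigenvalues → ℂ) :
      ∏ j, a j ^ α.mapDomain b.ev j = ∏ j, a j ^ s j := by
    rw [← b.prod_comp_ev]
    refine mul_right_cancel₀ (mem_support_iff.1 hα) ?_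
    rw [← coeff_bind₁_C_mul_X fun m => a (b.ev m), bind₁_C_mul_X_of_isOfType hQ hp, coeff_C_mul]
  have htwo := hprod (Function.update 1 j 2)
  simp only [Function.update_apply, Pi.one_apply, ite_pow, one_pow, Finset.prod_ite_eq',
    Finset.mem_univ, if_true] at htwo
  exact Nat.pow_right_injective le_rfl (by exact_mod_cast htwo)

lemma IsSubResonantTerm.mem_weightedMaps {Q : Cn n → Cn n} (hQ : IsSubResonantTerm L Q) :
    Q ∈ weightedMaps b.basis b.weight := by
  obtain ⟨hpoly, -, i, s, hi, hs, hle⟩ := hQ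
  intro k
  by_cases hk : b.ev k = i
  · obtain ⟨p, hp⟩ :=
      (mem_polyFunctions_iff b.basis).1 (isPolynomialMap_iff.1 hpoly (b.basis.coord k))
    refine ⟨p, fun α hα => ?_, hp⟩
    rw [Set.mem_ofPred_eq, b.weight_eq_neg_sum, mapDomain_ev_eq_of_isOfType hs hp hα,
      AdaptedBasis.weight, hk]
    exact neg_le_neg hle
  · exact ⟨0, Submodule.zero_mem _, fun z => by rw [b.repr_eq_zero (hi z) hk, map_zero]⟩

lemma SR_le_weightedMaps : SR L ≤ weightedMaps b.basis b.weight :=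
  Submodule.span_le.2 fun _ hQ => hQ.mem_weightedMaps

lemma isPolynomialMap_eval_smul (p : MvPolynomial ι ℂ) (v : Cn n) :
    IsPolynomialMap fun z => eval (b.basis.repr z) p • v := by
  refine isPolynomialMap_iff.2 fun φ => (mem_polyFunctions_iff b.basis).2 ⟨C (φ v) * p, fun z => ?_⟩
  simp [mul_comm]

lemma isSubResonantTerm_monomial {α : ι →₀ ℕ} (hα : α ≠ 0) {i : ι}
    (hle : Finsupp.weight b.weight α ≤ b.weight i) (c : ℂ) :
    IsSubResonantTerm L fun z => eval (b.basis.repr z) (monomial α c) • b.basis i := by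
  refine ⟨isPolynomialMap_eval_smul _ _, ?_, b.ev i, ⇑(α.mapDomain b.ev), fun z => ?_,
    fun a t ht => ?_, ?_⟩
  · obtain ⟨k, hk⟩ := Finsupp.ne_iff.1 hα
    have hprod : (α.prod fun k m => b.basis.repr (0 : Cn n) k ^ m) = 0 :=
      Finset.prod_eq_zero (i := k) (Finsupp.mem_support_iff.2 hk) (by simpa using hk)
    simp only [eval_monomial, hprod, mul_zero, zero_smul]
  · exact Submodule.smul_mem _ _ (b.basis_mem i)
  · simp only [eval_monomial, b.repr_sum_smul ht, mul_pow, Finsupp.prod_mul, b.prod_comp_ev,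
      mul_smul, smul_comm c]
  · rw [b.weight_eq_neg_sum, AdaptedBasis.weight] at hle
    exact neg_le_neg_iff.1 hle

lemma sub_apply_zero_mem_SR {P : Cn n → Cn n} (hP : P ∈ weightedMaps b.basis b.weight) :
    (fun z => P z - P 0) ∈ SR L := by
  classical
  have := Fintype.ofFinite ι
  choose p hp hPp using hP
  let term (i : ι) (α : ι →₀ ℕ) (z : Cn n) : Cn n :=
    eval (b.basis.repr z) (monomial α (coeff α (p i))) • b.basis i
  have hsum (z : Cn n) : P z = ∑ i, ∑ α ∈ (p i).support, term i α z := by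
    rw [← b.basis.sum_repr (P z)]
    refine Finset.sum_congr rfl fun i _ => ?_
    rw [hPp, ← Finset.sum_smul, ← map_sum, ← as_sum]
  have hsub : (fun z => P z - P 0) =
      ∑ i, ∑ α ∈ (p i).support, fun z => term i α z - term i α 0 := by
    funext z
    simp only [hsum, Finset.sum_apply, Finset.sum_sub_distrib]
  rw [hsub]
  refine Submodule.sum_mem _ fun i _ => Submodule.sum_mem _ fun α hα => ?_
  rcases eq_or_ne α 0 with rfl | hα0
  · convert Submodule.zero_mem (SR L)
    simp [term]
  · have hterm : IsSubResonantTerm L (term i α) := isSubResonantTerm_monomial hα0 (hp i hα) _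
    simp only [hterm.2.1, sub_zero]
    exact Submodule.subset_span hterm

lemma leftInverse_fderiv {𝕜 E E' : Type*} [NontriviallyNormedField 𝕜] [NormedAddCommGroup E]
    [NormedSpace 𝕜 E] [NormedAddCommGroup E'] [NormedSpace 𝕜 E'] {f : E → E'} {g : E' → E} {a : E}
    (hf : DifferentiableAt 𝕜 f a) (hg : DifferentiableAt 𝕜 g (f a))
    (h : ∀ᶠ z in 𝓝 a, g (f z) = z) :
    Function.LeftInverse (fderiv 𝕜 g (f a)) (fderiv 𝕜 f a) := by
  have hid := ((hg.hasFDerivAt.comp a hf.hasFDerivAt).congr_of_eventuallyEq (f₁ := id)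
    (h.mono fun _ hz => hz.symm)).unique (hasFDerivAt_id a)
  exact fun v => DFunLike.congr_fun hid v

lemma isUnit_fderiv_of_differentiable_symm {𝕜 E : Type*} [NontriviallyNormedField 𝕜]
    [NormedAddCommGroup E] [NormedSpace 𝕜 E] {g : Equiv.Perm E} (hg : Differentiable 𝕜 g)
    (hg' : Differentiable 𝕜 g.symm) (x : E) : IsUnit (fderiv 𝕜 g x) := by
  have hleft := leftInverse_fderiv (hg x) (hg' (g x)) (.of_forall g.symm_apply_apply)
  have hright := leftInverse_fderiv (hg' (g x)) (hg (g.symm (g x))) (.of_forall g.apply_symm_apply)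
  rw [g.symm_apply_apply] at hright
  exact ⟨⟨fderiv 𝕜 g x, fderiv 𝕜 g.symm (g x), ContinuousLinearMap.ext hright,
    ContinuousLinearMap.ext hleft⟩, rfl⟩

lemma addRight_mem_subResonantAffineGroup (τ : Cn n) :
    Equiv.addRight τ ∈ subResonantAffineGroup L :=
  Subgroup.subset_closure (Or.inr ⟨τ, rfl⟩)

lemma subResonantAffineGroup_eq_permGroup (hw : ∀ k, 0 < b.weight k) :
    subResonantAffineGroup L = (isCompositionMonoid_weightedMaps (b := b.basis) hw).permGroup := by
  have hV := isCompositionMonoid_weightedMaps (b := b.basis) hw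
  refine le_antisymm ((Subgroup.closure_le _).2 ?_) fun g hg => ?_
  · rintro g (hg | ⟨τ, rfl⟩)
    · exact SR_le_weightedMaps hg.1
    · exact Submodule.add_mem _ hV.id_mem (const_mem_weightedMaps hw τ)
  · have hdiff {h : Equiv.Perm (Cn n)} (hh : h ∈ hV.permGroup) : Differentiable ℂ h :=
      (hV.contDiff _ hh).differentiable (by simp)
    have hlinear : Equiv.addRight (-(g 0)) * g ∈ subResonantAffineGroup L := by
      have hcoe : ⇑(Equiv.addRight (-(g 0)) * g : Equiv.Perm (Cn n)) = fun z => g z - g 0 := by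
        funext z
        simp [sub_eq_add_neg]
      refine Subgroup.subset_closure (Or.inl ?_)
      simp only [Set.mem_ofPred_eq, SRstar, hcoe, fderiv_sub_const]
      exact ⟨sub_apply_zero_mem_SR hg,
        isUnit_fderiv_of_differentiable_symm (hdiff hg) (hdiff (hV.permGroup.inv_mem hg)) 0⟩
    convert Subgroup.mul_mem _ (addRight_mem_subResonantAffineGroup (g 0)) hlinear using 1
    ext1 z
    simp

theorem isHolomorphicHomogeneousSpace_subResonantAffineGroup
    (h0 : ∀ j : L.Eigenvalues, (j : ℂ) ≠ 0) (h1 : ∀ j : L.Eigenvalues, ‖(j : ℂ)‖ < 1) :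
    IsHolomorphicHomogeneousSpace (subResonantAffineGroup L) := by
  obtain ⟨b⟩ := exists_adaptedBasis L
  have hw := b.weight_pos h0 h1
  refine ⟨?_, fun x y => ⟨_, addRight_mem_subResonantAffineGroup (y - x), by simp⟩⟩
  rw [subResonantAffineGroup_eq_permGroup hw]
  exact ⟨_, (isCompositionMonoid_weightedMaps hw).exists_lieGroup finrank_euclideanSpace_fin⟩

end SubResonant

/-! ### Attracting neighbourhoods of a contracting fixed point -/

section AdaptedNorm

open Filter

lemma eventually_norm_pow_le_of_spectralRadius_lt {A : Type*} [NormedRing A] [NormedAlgebra ℂ A]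
    [CompleteSpace A] {a : A} {r : NNReal} (ha : spectralRadius ℂ a < r) :
    ∀ᶠ m : ℕ in atTop, ‖a ^ m‖ ≤ r ^ m := by
  have hlim := spectrum.pow_nnnorm_pow_one_div_tendsto_nhds_spectralRadius a
  filter_upwards [hlim.eventually_lt_const ha, eventually_gt_atTop 0] with m hm hm0
  have hpow := ENNReal.rpow_le_rpow hm.le m.cast_nonneg
  rw [← ENNReal.rpow_mul, one_div_mul_cancel (by exact_mod_cast hm0.ne'), ENNReal.rpow_one,
    ENNReal.rpow_natCast] at hpow
  exact_mod_cast hpow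

lemma spectralRadius_lt_one_of_hasEigenvalue {V : Type*} [NormedAddCommGroup V] [NormedSpace ℂ V]
    [FiniteDimensional ℂ V] {A : V →L[ℂ] V}
    (hA : ∀ μ : ℂ, Module.End.HasEigenvalue (A : V →ₗ[ℂ] V) μ → ‖μ‖ < 1) :
    spectralRadius ℂ A < 1 := by
  have := FiniteDimensional.complete ℂ V
  rcases subsingleton_or_nontrivial V with hV | hV
  · simp [spectrum.SpectralRadius.of_subsingleton]
  · refine spectrum.spectralRadius_lt_of_forall_lt A (r := 1) fun μ hμ => hA μ ?_
    rw [Module.End.hasEigenvalue_iff_mem_spectrum,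
      ← AlgEquiv.spectrum_eq (Module.End.toContinuousLinearMap (𝕜 := ℂ) V)]
    exact hμ

/-- The norm `∑_{k < m} q⁻ᵏ ‖Aᵏ z‖` makes `A` contract by `q` as soon as `‖Aᵐ‖ ≤ qᵐ`. -/
lemma exists_seminorm_map_le {𝕜 V : Type*} [NontriviallyNormedField 𝕜] [NormedAddCommGroup V]
    [NormedSpace 𝕜 V] {A : V →L[𝕜] V} {q : ℝ} (hq : 0 < q) {m : ℕ} (hm : 0 < m)
    (hA : ‖A ^ m‖ ≤ q ^ m) :
    ∃ (p : Seminorm 𝕜 V) (C : ℝ), (∀ z, ‖z‖ ≤ p z) ∧ (∀ z, p z ≤ C * ‖z‖) ∧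
      ∀ z, p (A z) ≤ q * p z := by
  let a (k : ℕ) (z : V) : ℝ := (q ^ k)⁻¹ * ‖(A ^ k) z‖
  have ha0 (z : V) : a 0 z = ‖z‖ := by simp [a]
  have ha (k : ℕ) (z : V) : 0 ≤ a k z := by positivity
  let p : Seminorm 𝕜 V := Seminorm.of (fun z => ∑ k ∈ Finset.range m, a k z)
    (fun x y => by
      rw [← Finset.sum_add_distrib]
      refine Finset.sum_le_sum fun k _ => ?_
      simp only [a, ← mul_add, map_add]
      gcongr
      exact norm_add_le _ _)
    fun c x => by simp only [a, map_smul, norm_smul, Finset.mul_sum, mul_left_comm]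
  refine ⟨p, ∑ k ∈ Finset.range m, (q ^ k)⁻¹ * ‖A ^ k‖, fun z => ?_, fun z => ?_, fun z => ?_⟩
  · rw [← ha0]
    exact Finset.single_le_sum (f := fun k => a k z) (fun k _ => ha k z) (Finset.mem_range.2 hm)
  · change ∑ k ∈ Finset.range m, a k z ≤ _
    rw [Finset.sum_mul]
    refine Finset.sum_le_sum fun k _ => ?_
    rw [mul_assoc]
    exact mul_le_mul_of_nonneg_left ((A ^ k).le_opNorm z) (by positivity)
  · have hshift (k : ℕ) : a k (A z) = q * a (k + 1) z := by
      simp only [a, pow_succ, mul_apply_eq_comp]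
      field_simp
    have hlast : a m z ≤ a 0 z := by
      rw [ha0, inv_mul_le_iff₀ (by positivity)]
      exact (A ^ m).le_of_opNorm_le hA z
    change ∑ k ∈ Finset.range m, a k (A z) ≤ q * ∑ k ∈ Finset.range m, a k z
    simp only [hshift, ← Finset.mul_sum]
    refine mul_le_mul_of_nonneg_left ?_ hq.le
    linarith [Finset.sum_range_succ (fun k => a k z) m, Finset.sum_range_succ' (fun k => a k z) m]

end AdaptedNorm

section AttractingNhd

open Filter Set

variable {V : Type*} [NormedAddCommGroup V] [NormedSpace ℂ V]

/-- An open neighbourhood `B` of the origin that is mapped into itself by the holomorphic map `f`,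
and on which the iterates of `f` converge geometrically to the origin. -/
structure IsAttractingNhd (f : V → V) (B : Set V) (C q : ℝ) : Prop where
  isOpen : IsOpen B
  zero_mem : (0 : V) ∈ B
  norm_le : ∀ z ∈ B, ‖z‖ ≤ 1
  mapsTo : MapsTo f B B
  differentiableOn : DifferentiableOn ℂ f B
  pos : 0 < q
  lt_one : q < 1
  norm_iterate_le : ∀ k, ∀ z ∈ B, ‖f^[k] z‖ ≤ C * q ^ k * ‖z‖

namespace IsAttractingNhd

variable {f f' : V → V} {B : Set V} {C q : ℝ}

lemma map_zero (hB : IsAttractingNhd f B C q) : f 0 = 0 := by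
  simpa using hB.norm_iterate_le 1 0 hB.zero_mem

lemma congr (hB : IsAttractingNhd f B C q) (h : EqOn f f' B) : IsAttractingNhd f' B C q where
  __ := hB
  mapsTo := hB.mapsTo.congr h
  differentiableOn := hB.differentiableOn.congr fun _ hz => (h hz).symm
  norm_iterate_le k z hz := by
    have hiter : f'^[k] z = f^[k] z := by
      induction k with
      | zero => rfl
      | succ k ih =>
        rw [Function.iterate_succ_apply', Function.iterate_succ_apply', ih,
          h (hB.mapsTo.iterate k hz)]
    exact hiter ▸ hB.norm_iterate_le k z hz

end IsAttractingNhd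

lemma eventually_seminorm_map_le {f : V → V} {A : V →L[ℂ] V} (hf : HasFDerivAt f A 0)
    (hf0 : f 0 = 0) {p : Seminorm ℂ V} {C q r : ℝ} (hC : ∀ z, p z ≤ C * ‖z‖)
    (hle : ∀ z, ‖z‖ ≤ p z) (hA : ∀ z, p (A z) ≤ q * p z) (hqr : q < r) :
    ∀ᶠ z in 𝓝 0, p (f z) ≤ r * p z := by
  have hε : 0 < (r - q) / (|C| + 1) := div_pos (sub_pos.2 hqr) (by positivity)
  filter_upwards [hf.isLittleO.bound hε] with z hz
  simp only [hf0, sub_zero] at hz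
  have hsmall : p (f z - A z) ≤ (r - q) * p z := calc
    p (f z - A z) ≤ (|C| + 1) * ‖f z - A z‖ :=
      (hC _).trans (by gcongr; linarith [le_abs_self C])
    _ ≤ (|C| + 1) * ((r - q) / (|C| + 1) * p z) := by
      gcongr
      exact hz.trans (by gcongr; exact hle z)
    _ = (r - q) * p z := by field_simp
  have htri := map_add_le_add p (f z - A z) (A z)
  rw [sub_add_cancel] at htri
  linarith [hA z]

theorem exists_isAttractingNhd [CompleteSpace V] {f : V → V} {U : Set V} (hU : IsOpen U)
    (h0 : (0 : V) ∈ U) (hf : DifferentiableOn ℂ f U) (hf0 : f 0 = 0)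
    (hA : spectralRadius ℂ (fderiv ℂ f 0) < 1) :
    ∃ (B : Set V) (C q : ℝ), B ⊆ U ∧ IsAttractingNhd f B C q := by
  obtain ⟨r, hAr, hr1⟩ := ENNReal.lt_iff_exists_nnreal_btwn.1 hA
  obtain ⟨q, hrq, hq1⟩ := exists_between (show (r : ℝ) < 1 by exact_mod_cast hr1)
  have hr0 : 0 < (r : ℝ) := NNReal.coe_pos.2 (ENNReal.coe_pos.1 (pos_of_gt hAr))
  have hq0 : 0 < q := hr0.trans hrq
  obtain ⟨m, hm, hm0⟩ :=
    ((eventually_norm_pow_le_of_spectralRadius_lt hAr).and (eventually_gt_atTop 0)).exists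
  obtain ⟨p, C, hle, hC, hpA⟩ := exists_seminorm_map_le hr0 hm0 hm
  have hp : Continuous p := Seminorm.continuous_of_le
    (q := C.toNNReal • normSeminorm ℂ V) (by continuity) fun z =>
      (hC z).trans (mul_le_mul_of_nonneg_right (Real.le_coe_toNNReal C) (norm_nonneg z))
  have hev := (hU.eventually_mem h0).and
    (eventually_seminorm_map_le (hf.differentiableAt (hU.mem_nhds h0)).hasFDerivAt hf0 hC hle hpA
      hrq)
  obtain ⟨ε, hε, hball⟩ := Metric.eventually_nhds_iff_ball.1 hev
  have hmem {z : V} (hz : p z < min ε 1) : z ∈ U ∧ p (f z) ≤ q * p z :=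
    hball z (mem_ball_zero_iff.2 ((hle z).trans_lt (hz.trans_le (min_le_left _ _))))
  have hmaps : MapsTo f {z | p z < min ε 1} {z | p z < min ε 1} := fun z hz =>
    ((hmem hz).2.trans (mul_le_of_le_one_left (apply_nonneg p z) hq1.le)).trans_lt hz
  refine ⟨{z | p z < min ε 1}, C, q, fun z hz => (hmem hz).1,
    isOpen_lt hp continuous_const, by simpa using hε, fun z hz =>
      (hle z).trans (hz.le.trans (min_le_right _ _)), hmaps, hf.mono fun z hz => (hmem hz).1, hq0,
    hq1, fun k z hz => ?_⟩
  have hiter : p (f^[k] z) ≤ q ^ k * p z := by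
    induction k with
    | zero => simp
    | succ k ih =>
      rw [Function.iterate_succ_apply', pow_succ', mul_assoc]
      exact (hmem (hmaps.iterate k hz)).2.trans (by gcongr)
  calc ‖f^[k] z‖ ≤ q ^ k * p z := (hle _).trans hiter
    _ ≤ q ^ k * (C * ‖z‖) := by gcongr; exact hC z
    _ = C * q ^ k * ‖z‖ := by ring

end AttractingNhd

/-! ### Generalized eigenvectors modulo an invariant subspace -/

section AlgHomGenEigenspace

variable {R A : Type*} [CommRing R] [CommRing A] [Algebra R A] (T : A →ₐ[R] A)

/-- The induction rests on the Leibniz rule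
`(T - μν) (x y) = (T - μ) x * T y + μ x * (T - ν) y`. -/
lemma pow_sub_smul_mul_eq_zero {μ ν : R} {k : ℕ} :
    ∀ {c d : ℕ}, c + d ≤ k → ∀ {x y : A}, ((T.toLinearMap - μ • 1) ^ c) x = 0 →
      ((T.toLinearMap - ν • 1) ^ d) y = 0 → ((T.toLinearMap - (μ * ν) • 1) ^ k) (x * y) = 0 := by
  induction k with
  | zero =>
    intro c d hcd x y hx _
    obtain rfl : c = 0 := by omega
    simp_all
  | succ k ih =>
    intro c d hcd x y hx hy
    rcases c with _ | c
    · simp_all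
    rcases d with _ | d
    · simp_all
    have leibniz : (T.toLinearMap - (μ * ν) • 1) (x * y) =
        (T.toLinearMap - μ • 1) x * T y + (μ • x) * (T.toLinearMap - ν • 1) y := by
      simp only [LinearMap.sub_apply, LinearMap.smul_apply, Module.End.one_apply,
        AlgHom.toLinearMap_apply, map_mul]
      simp only [Algebra.smul_def, map_mul]
      ring
    have hTy : ((T.toLinearMap - ν • 1) ^ (d + 1)) (T y) = 0 := by
      have hcomm : Commute ((T.toLinearMap - ν • 1) ^ (d + 1)) T.toLinearMap :=
        ((Commute.refl _).sub_left ((Commute.one_left _).smul_left ν)).pow_left _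
      have := LinearMap.congr_fun hcomm.eq y
      rwa [Module.End.mul_apply, Module.End.mul_apply, hy, map_zero] at this
    have hμx : ((T.toLinearMap - μ • 1) ^ (c + 1)) (μ • x) = 0 := by
      rw [map_smul, hx, smul_zero]
    rw [pow_succ, Module.End.mul_apply] at hx hy ⊢
    rw [leibniz, map_add, ih (by omega) hx hTy, ih (by omega) hμx hy, add_zero]

lemma mul_mem_maxGenEigenspace {μ ν : R} {x y : A}
    (hx : x ∈ Module.End.maxGenEigenspace T.toLinearMap μ)
    (hy : y ∈ Module.End.maxGenEigenspace T.toLinearMap ν) :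
    x * y ∈ Module.End.maxGenEigenspace T.toLinearMap (μ * ν) := by
  rw [Module.End.mem_maxGenEigenspace] at *
  obtain ⟨c, hc⟩ := hx
  obtain ⟨d, hd⟩ := hy
  exact ⟨c + d, pow_sub_smul_mul_eq_zero T le_rfl hc hd⟩

lemma prod_mem_maxGenEigenspace {κ : Type*} (s : Finset κ) {μ : κ → R} {x : κ → A}
    (hx : ∀ k ∈ s, x k ∈ Module.End.maxGenEigenspace T.toLinearMap (μ k)) :
    ∏ k ∈ s, x k ∈ Module.End.maxGenEigenspace T.toLinearMap (∏ k ∈ s, μ k) := by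
  classical
  induction s using Finset.induction_on with
  | empty => exact (Module.End.mem_maxGenEigenspace _ _ _).2 ⟨1, by simp⟩
  | insert k s hk ih =>
    rw [Finset.prod_insert hk, Finset.prod_insert hk]
    exact mul_mem_maxGenEigenspace T (hx k (Finset.mem_insert_self k s))
      (ih fun j hj => hx j (Finset.mem_insert_of_mem hj))

end AlgHomGenEigenspace

section InvariantSubspace

open Polynomial

variable {R A : Type*} [CommRing R] [AddCommGroup A] [Module R A] {T : Module.End R A}
  {K : Submodule R A}

lemma aeval_apply_mem (hK : K ∈ T.invtSubmodule) (p : R[X]) {x : A} (hx : x ∈ K) :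
    aeval T p x ∈ K := by
  have hx' : Module.AEval.of R A T x ∈ Module.AEval.mapSubmodule R A T ⟨K, hK⟩ := by simpa using hx
  simpa using (Module.AEval.mapSubmodule R A T ⟨K, hK⟩).smul_mem p hx'

lemma aeval_X_sub_C_pow (T : Module.End R A) (μ : R) (M : ℕ) :
    aeval T ((X - C μ) ^ M) = (T - μ • 1) ^ M := by
  rw [map_pow, map_sub, aeval_X, aeval_C, Algebra.algebraMap_eq_smul_one]

lemma exists_pow_apply_eq {S : Module.End R A} (hS : ∀ x ∈ K, ∃ y ∈ K, S y = x) (m : ℕ) :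
    ∀ x ∈ K, ∃ y ∈ K, (S ^ m) y = x := by
  induction m with
  | zero => exact fun x hx => ⟨x, hx, rfl⟩
  | succ m ih =>
    intro x hx
    obtain ⟨y, hy, rfl⟩ := ih x hx
    obtain ⟨z, hz, rfl⟩ := hS y hy
    exact ⟨z, hz, by rw [pow_succ]; rfl⟩

lemma mkQ_mem_maxGenEigenspace_mapQ (hK : K ≤ K.comap T) {μ : R} {x : A}
    (hx : x ∈ T.maxGenEigenspace μ) : K.mkQ x ∈ Module.End.maxGenEigenspace (K.mapQ K T hK) μ := by
  rw [Module.End.mem_maxGenEigenspace] at hx ⊢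
  obtain ⟨m, hm⟩ := hx
  refine ⟨m, ?_⟩
  let Tq : Module.End R (A ⧸ K) := K.mapQ K T hK
  have hpow (m : ℕ) (x : A) : ((Tq - μ • 1) ^ m) (K.mkQ x) = K.mkQ (((T - μ • 1) ^ m) x) := by
    induction m generalizing x with
    | zero => rfl
    | succ m ih =>
      rw [pow_succ, pow_succ, Module.End.mul_apply, Module.End.mul_apply, ← ih]
      rfl
  exact (hpow m x).trans (by rw [hm, map_zero])

end InvariantSubspace

section InvariantSubspaceField

open Polynomial

variable {k A : Type*} [Field k] [AddCommGroup A] [Module k A] {T : Module.End k A}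
  {K : Submodule k A}

lemma exists_aeval_apply_mem {E S : Submodule k A} [FiniteDimensional k S]
    (hE : E ∈ T.invtSubmodule) (hES : E ≤ S ⊔ K) {x : A} (hx : x ∈ E) :
    ∃ p : k[X], p ≠ 0 ∧ aeval T p x ∈ K := by
  let Φ : k[X] →ₗ[k] A ⧸ K :=
    K.mkQ ∘ₗ LinearMap.applyₗ x ∘ₗ (aeval T : k[X] →ₐ[k] Module.End k A).toLinearMap
  have hmem (p : k[X]) : Φ p ∈ S.map K.mkQ := by
    have hsup : Φ p ∈ (S ⊔ K).map K.mkQ :=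
      Submodule.mem_map_of_mem (hES (aeval_apply_mem hE p hx))
    rwa [Submodule.map_sup, Submodule.mkQ_map_self, sup_bot_eq] at hsup
  by_contra! hcon
  have hinj : Function.Injective (Φ.codRestrict _ hmem) := by
    refine LinearMap.ker_eq_bot.1 (LinearMap.ker_eq_bot'.2 fun p hp => ?_)
    by_contra hp0
    exact hcon p hp0 ((Submodule.Quotient.mk_eq_zero K).1 (congrArg Subtype.val hp))
  exact Polynomial.not_finite (R := k) (Module.Finite.of_injective _ hinj)

/-- The polynomial `1 - u (X - μ) ^ M` projects to the eigenvalue `μ` modulo `K`. -/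
lemma exists_component {p : k[X]} (hp : p ≠ 0) (hK : K ∈ T.invtSubmodule) {x : A}
    (hx : aeval T p x ∈ K) (μ : k) (M₀ : ℕ) :
    ∃ (M : ℕ) (u : k[X]), M₀ ≤ M ∧
      ((T - μ • 1) ^ M) (x - aeval T (u * (X - C μ) ^ M) x) ∈ K := by
  obtain ⟨r, hpr, hr⟩ := Polynomial.exists_eq_pow_rootMultiplicity_mul_and_not_dvd p hp μ
  set a := p.rootMultiplicity μ
  have hcop : IsCoprime ((X - C μ) ^ max M₀ a) r :=
    ((Polynomial.irreducible_X_sub_C μ).coprime_iff_not_dvd.2 hr).pow_left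
  obtain ⟨u, v, huv⟩ := hcop
  refine ⟨max M₀ a, u, le_max_left _ _, ?_⟩
  have hsub : x - aeval T (u * (X - C μ) ^ max M₀ a) x = aeval T (v * r) x := by
    rw [sub_eq_iff_eq_add', ← LinearMap.add_apply, ← map_add, huv, map_one, Module.End.one_apply]
  have hdvd : (X - C μ) ^ max M₀ a * (v * r) = (v * (X - C μ) ^ (max M₀ a - a)) * p := by
    conv_rhs => rw [hpr]
    rw [← pow_sub_mul_pow _ (le_max_right M₀ a)]
    ring
  rw [hsub, ← aeval_X_sub_C_pow, ← Module.End.mul_apply, ← map_mul, hdvd, map_mul,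
    Module.End.mul_apply]
  exact aeval_apply_mem hK _ hx

/-- A vector of an invariant subspace `E` that is finite-dimensional modulo `K` can be corrected to
a generalized eigenvector, by an error in `K` and one in the range of a high power of `T - μ`. -/
lemma exists_sub_sub_mem_maxGenEigenspace {E S : Submodule k A} [FiniteDimensional k S]
    (hE : E ∈ T.invtSubmodule) (hK : K ∈ T.invtSubmodule) (hES : E ≤ S ⊔ K) {μ : k}
    (hμ : ∀ x ∈ K, ∃ y ∈ K, (T - μ • 1) y = x) {x : A} (hx : x ∈ E) (M₀ : ℕ) :
    ∃ (M : ℕ) (u : k[X]), M₀ ≤ M ∧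
      ∃ y ∈ K, x - aeval T (u * (X - C μ) ^ M) x - y ∈ T.maxGenEigenspace μ := by
  obtain ⟨p, hp0, hp⟩ := exists_aeval_apply_mem hE hES hx
  obtain ⟨M, u, hM, hmem⟩ := exists_component hp0 hK hp μ M₀
  obtain ⟨y, hy, hyM⟩ := exists_pow_apply_eq hμ M _ hmem
  refine ⟨M, u, hM, y, hy, (Module.End.mem_maxGenEigenspace _ _ _).2 ⟨M, ?_⟩⟩
  rw [map_sub, hyM, sub_self]

/-- Modulo `K`, only the summands for the same eigenvalue contribute to a generalized
eigenvector. -/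
lemma sub_sum_filter_mem (hK : K ∈ T.invtSubmodule) {μ : k} {x : A}
    (hx : x ∈ T.maxGenEigenspace μ) {κ : Type*} [Fintype κ] {ν : κ → k} {y : κ → A}
    (hy : ∀ i, y i ∈ T.maxGenEigenspace (ν i)) [DecidablePred fun i => ν i = μ]
    (hxy : x - ∑ i, y i ∈ K) : x - ∑ i with ν i = μ, y i ∈ K := by
  set w := x - ∑ i with ν i = μ, y i with hw
  have hsum : K.mkQ w = ∑ i with ¬ ν i = μ, K.mkQ (y i) := by
    rw [← map_sum, ← sub_eq_zero, ← map_sub, hw, sub_sub, Finset.sum_filter_add_sum_filter_not]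
    exact (Submodule.Quotient.mk_eq_zero K).2 hxy
  let Tq : Module.End k (A ⧸ K) := K.mapQ K T hK
  have hmem : K.mkQ w ∈ Tq.maxGenEigenspace μ := by
    refine mkQ_mem_maxGenEigenspace_mapQ hK (Submodule.sub_mem _ hx
      (Submodule.sum_mem _ fun i hi => ?_))
    rw [← (Finset.mem_filter.1 hi).2]
    exact hy i
  have hmem' : K.mkQ w ∈ ⨆ j ≠ μ, Tq.maxGenEigenspace j := by
    rw [hsum]
    exact Submodule.sum_mem _ fun i hi => Submodule.mem_iSup_of_mem (ν i)
      (Submodule.mem_iSup_of_mem (Finset.mem_filter.1 hi).2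
        (mkQ_mem_maxGenEigenspace_mapQ hK (hy i)))
  exact (Submodule.Quotient.mk_eq_zero K).1 (Submodule.disjoint_def.1
    (Tq.independent_maxGenEigenspace μ) _ hmem hmem')

end InvariantSubspaceField

/-! ### Holomorphic functions on an attracting neighbourhood -/

section VanishingHolomorphic

open Filter Set Asymptotics

variable {V : Type*} [NormedAddCommGroup V] [NormedSpace ℂ V] {B : Set V}

/-- The functions that are holomorphic on `B` and bounded there by a multiple of `‖z‖ ^ N`; in
particular the bounded holomorphic functions for `N = 0`. Nothing is required off `B`. -/
def vanishingHolomorphic (B : Set V) (N : ℕ) : Submodule ℂ (V → ℂ) where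
  carrier := {g | DifferentiableOn ℂ g B ∧ g =O[𝓟 B] fun z => ‖z‖ ^ N}
  zero_mem' := ⟨differentiableOn_const 0, isBigO_zero _ _⟩
  add_mem' hg hh := ⟨hg.1.add hh.1, hg.2.add hh.2⟩
  smul_mem' a _ hg := ⟨hg.1.const_smul a, hg.2.const_smul_left a⟩

lemma mul_mem_vanishingHolomorphic {g h : V → ℂ} {M N : ℕ} (hg : g ∈ vanishingHolomorphic B M)
    (hh : h ∈ vanishingHolomorphic B N) : g * h ∈ vanishingHolomorphic B (M + N) :=
  ⟨hg.1.mul hh.1, (hg.2.mul hh.2).congr_right fun z => (pow_add ‖z‖ M N).symm⟩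

lemma prod_mem_vanishingHolomorphic {κ : Type*} (s : Finset κ) {g : κ → V → ℂ} {N : κ → ℕ}
    (hg : ∀ k ∈ s, g k ∈ vanishingHolomorphic B (N k)) :
    ∏ k ∈ s, g k ∈ vanishingHolomorphic B (∑ k ∈ s, N k) := by
  classical
  induction s using Finset.induction_on with
  | empty => exact ⟨differentiableOn_const 1, .of_bound 1 (by simp)⟩
  | insert k s hk ih =>
    rw [Finset.prod_insert hk, Finset.sum_insert hk]
    exact mul_mem_vanishingHolomorphic (hg k (Finset.mem_insert_self k s))
      (ih fun j hj => hg j (Finset.mem_insert_of_mem hj))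

lemma vanishingHolomorphic_anti (hB : ∀ z ∈ B, ‖z‖ ≤ 1) {M N : ℕ} (h : M ≤ N) :
    vanishingHolomorphic B N ≤ vanishingHolomorphic B M := fun _ hg =>
  ⟨hg.1, hg.2.trans (.of_bound 1 (eventually_principal.2 fun z hz => by
    simpa using pow_le_pow_of_le_one (norm_nonneg z) (hB z hz) h))⟩

lemma exists_norm_le_of_mem_vanishingHolomorphic {g : V → ℂ} {N : ℕ}
    (hg : g ∈ vanishingHolomorphic B N) : ∃ D, 0 ≤ D ∧ ∀ z ∈ B, ‖g z‖ ≤ D * ‖z‖ ^ N := by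
  obtain ⟨D, hD, h⟩ := hg.2.exists_nonneg
  exact ⟨D, hD, by simpa using h.bound⟩

lemma apply_zero_of_mem_vanishingHolomorphic (h0 : (0 : V) ∈ B) {g : V → ℂ} {N : ℕ} (hN : N ≠ 0)
    (hg : g ∈ vanishingHolomorphic B N) : g 0 = 0 := by
  obtain ⟨D, -, hD⟩ := exists_norm_le_of_mem_vanishingHolomorphic hg
  simpa [hN] using hD 0 h0

/-- Away from the origin the bound by `‖z‖ ^ N` is a consequence of boundedness. -/
lemma mem_vanishingHolomorphic_of_isBigO_nhds {g : V → ℂ} (hg : g ∈ vanishingHolomorphic B 0)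
    {N : ℕ} (hO : g =O[𝓝 0] fun z => ‖z‖ ^ N) : g ∈ vanishingHolomorphic B N := by
  refine ⟨hg.1, ?_⟩
  obtain ⟨c, hc⟩ := hO.bound
  obtain ⟨δ, hδ, hball⟩ := Metric.eventually_nhds_iff_ball.1 hc
  obtain ⟨D, hD0, hD⟩ := exists_norm_le_of_mem_vanishingHolomorphic hg
  refine IsBigO.of_bound (max c (D / δ ^ N)) (eventually_principal.2 fun z hz => ?_)
  by_cases hzδ : z ∈ Metric.ball (0 : V) δ
  · exact (hball z hzδ).trans (by gcongr; exact le_max_left _ _)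
  · have hδz : δ ≤ ‖z‖ := by simpa using hzδ
    rw [norm_pow, norm_norm]
    calc ‖g z‖ ≤ D := by simpa using hD z hz
      _ = D / δ ^ N * δ ^ N := by field_simp
      _ ≤ max c (D / δ ^ N) * ‖z‖ ^ N := by gcongr; exact le_max_right _ _

/-- Composition on the right with `f`, as an algebra endomorphism of the functions. -/
def precomp (R : Type*) [CommSemiring R] {X : Type*} (f : X → X) : (X → R) →ₐ[R] (X → R) where
  toFun g := g ∘ f
  map_one' := rfl
  map_mul' _ _ := rfl
  map_zero' := rfl
  map_add' _ _ := rfl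
  commutes' _ := rfl

lemma precomp_pow_apply (R : Type*) [CommSemiring R] {X : Type*} (f : X → X) (m : ℕ) (g : X → R) :
    ((precomp R f).toLinearMap ^ m) g = g ∘ f^[m] := by
  induction m generalizing g with
  | zero => rfl
  | succ m ih => rw [pow_succ, Module.End.mul_apply, ih, Function.iterate_succ']; rfl

namespace IsAttractingNhd

variable {f : V → V} {C q : ℝ}

lemma norm_comp_iterate_le (hB : IsAttractingNhd f B C q) {g : V → ℂ} {N : ℕ}
    (hg : g ∈ vanishingHolomorphic B N) :
    ∃ D, ∀ k, ∀ z ∈ B, ‖g (f^[k] z)‖ ≤ D * (q ^ N) ^ k * ‖z‖ ^ N := by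
  have hq := hB.pos
  obtain ⟨D, hD0, hD⟩ := exists_norm_le_of_mem_vanishingHolomorphic hg
  refine ⟨D * |C| ^ N, fun k z hz => ?_⟩
  calc ‖g (f^[k] z)‖ ≤ D * ‖f^[k] z‖ ^ N := hD _ (hB.mapsTo.iterate k hz)
    _ ≤ D * (|C| * q ^ k * ‖z‖) ^ N := by
      gcongr
      exact (hB.norm_iterate_le k z hz).trans (by gcongr; exact le_abs_self C)
    _ = D * |C| ^ N * (q ^ N) ^ k * ‖z‖ ^ N := by
      rw [mul_pow, mul_pow, ← pow_mul, ← pow_mul, mul_comm k N]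
      ring

lemma vanishingHolomorphic_mem_invtSubmodule (hB : IsAttractingNhd f B C q) (N : ℕ) :
    vanishingHolomorphic B N ∈ Module.End.invtSubmodule (precomp ℂ f).toLinearMap := by
  intro g hg
  obtain ⟨D, hD⟩ := hB.norm_comp_iterate_le hg
  refine ⟨hg.1.comp hB.differentiableOn hB.mapsTo, IsBigO.of_bound (D * (q ^ N) ^ 1)
    (eventually_principal.2 fun z hz => ?_)⟩
  rw [norm_pow, norm_norm]
  exact hD 1 z hz

lemma exists_summable_norm_le (hB : IsAttractingNhd f B C q) {N : ℕ} {μ : ℂ} (hμ : q ^ N < ‖μ‖)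
    {g : V → ℂ} (hg : g ∈ vanishingHolomorphic B N) :
    ∃ a : ℕ → ℝ, Summable a ∧
      ∀ k, ∀ z ∈ B, ‖μ⁻¹ ^ (k + 1) * g (f^[k] z)‖ ≤ a k * ‖z‖ ^ N := by
  have hq := hB.pos
  have hμ0 : 0 < ‖μ‖ := (pow_pos hq N).trans hμ
  obtain ⟨D, hD⟩ := hB.norm_comp_iterate_le hg
  refine ⟨fun k => ‖μ‖⁻¹ * D * (q ^ N / ‖μ‖) ^ k,
    (summable_geometric_of_lt_one (by positivity) ((div_lt_one hμ0).2 hμ)).mul_left _,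
    fun k z hz => ?_⟩
  calc ‖μ⁻¹ ^ (k + 1) * g (f^[k] z)‖ = ‖μ‖⁻¹ ^ (k + 1) * ‖g (f^[k] z)‖ := by
        rw [norm_mul, norm_pow, norm_inv]
    _ ≤ ‖μ‖⁻¹ ^ (k + 1) * (D * (q ^ N) ^ k * ‖z‖ ^ N) := by gcongr; exact hD k z hz
    _ = ‖μ‖⁻¹ * D * (q ^ N / ‖μ‖) ^ k * ‖z‖ ^ N := by
      simp only [pow_succ, div_eq_mul_inv, mul_pow]
      ring

/-- The solution is the series `-∑ μ ^ (-k-1) g ∘ f ^ k`. -/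
lemma exists_sub_smul_eq [FiniteDimensional ℂ V] (hB : IsAttractingNhd f B C q)
    (hfB : ∀ z, f z ∈ B) {N : ℕ} {μ : ℂ} (hμ : q ^ N < ‖μ‖) {g : V → ℂ}
    (hg : g ∈ vanishingHolomorphic B N) :
    ∃ u ∈ vanishingHolomorphic B N, ((precomp ℂ f).toLinearMap - μ • 1) u = g := by
  have hμ0 : μ ≠ 0 := norm_pos_iff.1 ((pow_pos hB.pos N).trans hμ)
  let t (k : ℕ) (z : V) : ℂ := μ⁻¹ ^ (k + 1) * g (f^[k] z)
  obtain ⟨a, ha, hta⟩ : ∃ a, Summable a ∧ ∀ k, ∀ z ∈ B, ‖t k z‖ ≤ a k * ‖z‖ ^ N :=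
    hB.exists_summable_norm_le hμ hg
  have htB (k : ℕ) (z : V) (hz : z ∈ B) : ‖t k z‖ ≤ |a k| :=
    (hta k z hz).trans ((mul_le_mul_of_nonneg_right (le_abs_self _) (by positivity)).trans
      (mul_le_of_le_one_right (abs_nonneg _) (pow_le_one₀ (norm_nonneg z) (hB.norm_le z hz))))
  have hshift (k : ℕ) (z : V) : t k (f z) = μ * t (k + 1) z := by
    simp only [t, Function.iterate_succ_apply, pow_succ]
    field_simp
  have hsum (z : V) : Summable fun k => t k z := by
    rw [← summable_nat_add_iff 1, ← summable_mul_left_iff hμ0]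
    simp only [← hshift]
    exact .of_norm_bounded ha.abs fun k => htB k _ (hfB z)
  refine ⟨fun z => -∑' k, t k z, ⟨?_, IsBigO.of_bound (∑' k, a k)
    (eventually_principal.2 fun z hz => ?_)⟩, ?_⟩
  · exact (differentiableOn_tsum_of_norm_le hB.isOpen ha.abs (fun k => (hg.1.comp
      (hB.differentiableOn.iterate hB.mapsTo k) (hB.mapsTo.iterate k)).const_mul _) htB).neg
  · rw [norm_neg, norm_pow, norm_norm, ← tsum_mul_right]
    exact tsum_of_norm_bounded (ha.mul_right _).hasSum fun k => hta k z hz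
  · funext z
    change -∑' k, t k (f z) - μ • (-∑' k, t k z) = g z
    have ht0 : t 0 z = μ⁻¹ * g z := by simp [t]
    simp only [hshift, tsum_mul_left, smul_eq_mul]
    rw [(hsum z).tsum_eq_zero_add, ht0]
    field_simp
    ring

lemma eqOn_zero_of_comp_eq (hB : IsAttractingNhd f B C q) {N : ℕ} {μ : ℂ} (hμ : q ^ N < ‖μ‖)
    {g : V → ℂ} (hg : g ∈ vanishingHolomorphic B N) (h : ∀ z ∈ B, g (f z) = μ * g z) :
    EqOn g 0 B := by
  intro z hz
  have hμ0 : μ ≠ 0 := norm_pos_iff.1 ((pow_pos hB.pos N).trans hμ)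
  have hiter (k : ℕ) : g (f^[k] z) = μ ^ k * g z := by
    induction k with
    | zero => simp
    | succ k ih =>
      rw [Function.iterate_succ_apply', h _ (hB.mapsTo.iterate k hz), ih, pow_succ', mul_assoc]
  obtain ⟨a, ha, hle⟩ := hB.exists_summable_norm_le hμ hg
  have hle' (k : ℕ) : ‖μ⁻¹ * g z‖ ≤ a k * ‖z‖ ^ N := by
    have hk := hle k z hz
    rwa [hiter, pow_succ', mul_assoc, ← mul_assoc (μ⁻¹ ^ k), ← mul_pow, inv_mul_cancel₀ hμ0,
      one_pow, one_mul] at hk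
  have hzero : μ⁻¹ * g z = 0 := norm_le_zero_iff.1
    (ge_of_tendsto' (by simpa using ha.tendsto_atTop_zero.mul_const (‖z‖ ^ N)) hle')
  exact (mul_eq_zero.1 hzero).resolve_left (inv_ne_zero hμ0)

lemma eqOn_zero_of_mem_maxGenEigenspace (hB : IsAttractingNhd f B C q) {N : ℕ} {μ : ℂ}
    (hμ : q ^ N < ‖μ‖) {g : V → ℂ} (hg : g ∈ vanishingHolomorphic B N)
    (h : g ∈ Module.End.maxGenEigenspace (precomp ℂ f).toLinearMap μ) : EqOn g 0 B := by
  rw [Module.End.mem_maxGenEigenspace] at h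
  obtain ⟨m, hm⟩ := h
  induction m generalizing g with
  | zero => exact fun z _ => congrFun hm z
  | succ m ih =>
    have hmem : ((precomp ℂ f).toLinearMap - μ • 1) g ∈ vanishingHolomorphic B N :=
      Submodule.sub_mem _ (hB.vanishingHolomorphic_mem_invtSubmodule N hg)
        (Submodule.smul_mem _ μ hg)
    rw [pow_succ] at hm
    exact hB.eqOn_zero_of_comp_eq hμ hg fun z hz => sub_eq_zero.1 (ih hmem hm hz)

end IsAttractingNhd

end VanishingHolomorphic

/-! ### Resonant normal form -/

section TaylorExpansion

open Filter Asymptotics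

variable {𝕜 V E ι : Type*} [NontriviallyNormedField 𝕜] [NormedAddCommGroup V] [NormedSpace 𝕜 V]
  [NormedAddCommGroup E] [NormedSpace 𝕜 E]

lemma exists_isBigO_sub_sum_repr [Fintype ι] (β : Module.Basis ι 𝕜 V) {g : V → E}
    (hg : AnalyticAt 𝕜 g 0) (N : ℕ) : ∃ c : (Σ k : Fin N, (Fin k → ι)) → E,
      (fun z => g z - ∑ x, (∏ j, β.repr z (x.2 j)) • c x) =O[𝓝 0] fun z => ‖z‖ ^ N := by
  obtain ⟨p, hp⟩ := hg
  refine ⟨fun x => p x.1 fun j => β (x.2 j),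
    (hp.isBigO_sub_partialSum_pow N).congr_left fun z => ?_⟩
  have hpow (k : ℕ) : (p k fun _ => z) =
      ∑ x : Fin k → ι, (∏ j, β.repr z (x j)) • p k fun j => β (x j) := by
    conv_lhs => rw [← β.sum_repr z, ContinuousMultilinearMap.map_sum]
    exact Finset.sum_congr rfl fun x _ => ContinuousMultilinearMap.map_smul_univ _ _ _
  rw [zero_add, FormalMultilinearSeries.partialSum, Fintype.sum_sigma,
    ← Fin.sum_univ_eq_sum_range (fun k => p k fun _ => z)]
  simp only [hpow]

lemma exists_analyticAt_leftInverse {𝕜 V E : Type*} [RCLike 𝕜] [NormedAddCommGroup V]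
    [NormedSpace 𝕜 V] [CompleteSpace V] [NormedAddCommGroup E] [NormedSpace 𝕜 E] {g : V → E}
    {A : V ≃L[𝕜] E} {a : V} (hg : AnalyticAt 𝕜 g a) (hA : HasFDerivAt g (A : V →L[𝕜] E) a) :
    ∃ h : E → V, AnalyticAt 𝕜 h (g a) ∧ ∀ᶠ z in 𝓝 a, h (g z) = z := by
  have := (completeSpace_congr (e := A.toEquiv) A.isUniformEmbedding).1 ‹_›
  have hω : (ω : WithTop ℕ∞) ≠ 0 := by simp
  exact ⟨_, (hg.contDiffAt.to_localInverse hA hω).analyticAt,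
    (hg.contDiffAt.hasStrictFDerivAt' hA hω).eventually_left_inverse⟩

end TaylorExpansion

section MapOfCoords

variable {R X V ι : Type*} [CommRing R] [AddCommGroup V] [Module R V] [Fintype ι]

/-- The map whose coordinates in the basis `β` are the functions `φ i`. -/
noncomputable def mapOfCoords (β : Module.Basis ι R V) (φ : ι → X → R) (z : X) : V :=
  ∑ i, φ i z • β i

lemma repr_mapOfCoords (β : Module.Basis ι R V) (φ : ι → X → R) (z : X) (i : ι) :
    β.repr (mapOfCoords β φ z) i = φ i z := by
  rw [mapOfCoords, β.repr_sum_self]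

end MapOfCoords

section CoordSystem

open Filter Asymptotics

variable {V ι : Type*} [NormedAddCommGroup V] [NormedSpace ℂ V] [FiniteDimensional ℂ V]
  {β : Module.Basis ι ℂ V} {B : Set V} {φ : ι → V → ℂ}

/-- Bounded holomorphic functions `φ i` on `B` that vanish at the origin and are tangent there to
the linear coordinates of the basis `β`. -/
structure IsCoordSystem (β : Module.Basis ι ℂ V) (B : Set V) (φ : ι → V → ℂ) : Prop where
  mem : ∀ i, φ i ∈ vanishingHolomorphic B 1
  hasFDerivAt : ∀ i, HasFDerivAt (φ i) (LinearMap.toContinuousLinearMap (β.coord i)) 0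

lemma isCoordSystem_coord (β : Module.Basis ι ℂ V) (B : Set V) :
    IsCoordSystem β B fun i => β.coord i where
  mem i := by
    let ℓ := LinearMap.toContinuousLinearMap (β.coord i)
    exact ⟨ℓ.differentiable.differentiableOn, .of_bound ‖ℓ‖ (.of_forall fun z => by
      rw [pow_one, norm_norm]
      exact ℓ.le_opNorm z)⟩
  hasFDerivAt i := (LinearMap.toContinuousLinearMap (β.coord i)).hasFDerivAt

variable [Fintype ι]

namespace IsCoordSystem

lemma mapOfCoords_zero (hφ : IsCoordSystem β B φ) (h0 : (0 : V) ∈ B) : mapOfCoords β φ 0 = 0 := by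
  simp [mapOfCoords, apply_zero_of_mem_vanishingHolomorphic h0 one_ne_zero (hφ.mem _)]

lemma differentiableOn_mapOfCoords (hφ : IsCoordSystem β B φ) :
    DifferentiableOn ℂ (mapOfCoords β φ) B :=
  DifferentiableOn.fun_sum fun i _ => (hφ.mem i).1.smul_const (β i)

lemma hasFDerivAt_mapOfCoords (hφ : IsCoordSystem β B φ) :
    HasFDerivAt (mapOfCoords β φ) (ContinuousLinearEquiv.refl ℂ V : V →L[ℂ] V) 0 := by
  have h := HasFDerivAt.fun_sum (u := Finset.univ) fun i _ => (hφ.hasFDerivAt i).smul_const (β i)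
  refine h.congr_fderiv (ContinuousLinearMap.ext fun z => ?_)
  simp [β.sum_repr z]

lemma exists_isBigO_sub_sum (hφ : IsCoordSystem β B φ) (hB : B ∈ 𝓝 (0 : V)) {g : V → ℂ}
    (hg : AnalyticAt ℂ g 0) (hΦ : AnalyticAt ℂ (mapOfCoords β φ) 0) (N : ℕ) :
    ∃ c : (Σ k : Fin N, (Fin k → ι)) → ℂ,
      (g - ∑ x, c x • ∏ j, φ (x.2 j)) =O[𝓝 0] fun z => ‖z‖ ^ N := by
  have := FiniteDimensional.complete ℂ V
  have hΦ0 : mapOfCoords β φ 0 = 0 := hφ.mapOfCoords_zero (mem_of_mem_nhds hB)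
  obtain ⟨ψ, hψ, hψΦ⟩ := exists_analyticAt_leftInverse hΦ hφ.hasFDerivAt_mapOfCoords
  have hψ0 : ψ 0 = 0 := by simpa only [hΦ0] using hψΦ.self_of_nhds
  rw [hΦ0] at hψ
  obtain ⟨c, hc⟩ := exists_isBigO_sub_sum_repr β (hg.comp_of_eq hψ hψ0) N
  have hΦO : (fun z => ‖mapOfCoords β φ z‖ ^ N) =O[𝓝 0] fun z => ‖z‖ ^ N := by
    simpa [hΦ0] using hφ.hasFDerivAt_mapOfCoords.isBigO_sub.norm_norm.pow N
  have hΦt : Tendsto (mapOfCoords β φ) (𝓝 0) (𝓝 0) := by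
    simpa [hΦ0] using hΦ.continuousAt.tendsto
  refine ⟨c, ((hc.comp_tendsto hΦt).trans hΦO).congr' ?_ .rfl⟩
  filter_upwards [hψΦ] with z hz
  simp [hz, repr_mapOfCoords, mul_comm]

lemma exists_sub_sum_mem (hφ : IsCoordSystem β B φ) (hBo : IsOpen B) (h0 : (0 : V) ∈ B)
    (hB : ∀ z ∈ B, ‖z‖ ≤ 1) {g : V → ℂ} (hg : g ∈ vanishingHolomorphic B 0) (N : ℕ) :
    ∃ c : (Σ k : Fin N, (Fin k → ι)) → ℂ,
      g - ∑ x, c x • ∏ j, φ (x.2 j) ∈ vanishingHolomorphic B N := by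
  obtain ⟨c, hc⟩ := hφ.exists_isBigO_sub_sum (hBo.mem_nhds h0)
    (analyticOnNhd_of_differentiableOn hBo hg.1 0 h0)
    (analyticOnNhd_of_differentiableOn hBo hφ.differentiableOn_mapOfCoords 0 h0) N
  refine ⟨c, mem_vanishingHolomorphic_of_isBigO_nhds (sub_mem hg (sum_mem fun x _ => ?_)) hc⟩
  exact Submodule.smul_mem _ _ (vanishingHolomorphic_anti hB (Nat.zero_le _)
    (prod_mem_vanishingHolomorphic _ fun j _ => hφ.mem _))

end IsCoordSystem

end CoordSystem

section EigenCoord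

open Polynomial

lemma AdaptedBasis.coord_comp_pow_eq_zero {K V ι : Type*} [Field K] [AddCommGroup V] [Module K V]
    [FiniteDimensional K V] {L : Module.End K V} (b : AdaptedBasis L ι) (i : ι) {M : ℕ}
    (hM : Module.finrank K V ≤ M) :
    b.basis.coord i ∘ₗ (L - (b.ev i : K) • 1) ^ M = 0 := by
  refine b.basis.ext fun k => ?_
  rw [LinearMap.comp_apply, LinearMap.zero_apply]
  by_cases hk : b.ev i = b.ev k
  · have hker : b.basis k ∈ L.genEigenspace (b.ev i) M := by
      refine (L.genEigenspace _).monotone (Nat.cast_le.2 hM) ?_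
      rw [hk, ← Module.End.maxGenEigenspace_eq_genEigenspace_finrank]
      exact b.basis_mem k
    rw [Module.End.mem_genEigenspace_nat, LinearMap.mem_ker] at hker
    rw [hker, map_zero]
  · have hcomm : Commute L ((L - (b.ev i : K) • 1) ^ M) :=
      ((Commute.refl L).sub_right ((Commute.one_right L).smul_right _)).pow_right M
    exact b.repr_eq_zero (Module.End.mapsTo_maxGenEigenspace_of_comm hcomm _ (b.basis_mem k)) hk

lemma hasFDerivAt_aeval_precomp {𝕜 V : Type*} [NontriviallyNormedField 𝕜] [NormedAddCommGroup V]
    [NormedSpace 𝕜 V] {f : V → V} {A : V →L[𝕜] V} {a : V} (hf : HasFDerivAt f A a) (ha : f a = a)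
    {g : V → 𝕜} {ℓ : V →L[𝕜] 𝕜} (hg : HasFDerivAt g ℓ a) (p : 𝕜[X]) :
    HasFDerivAt (aeval (precomp 𝕜 f).toLinearMap p g) (ℓ.comp (aeval A p)) a := by
  induction p using Polynomial.induction_on' with
  | add p r hp hr =>
    rw [map_add, map_add, ContinuousLinearMap.comp_add]
    exact hp.add hr
  | monomial m c =>
    have hg' : HasFDerivAt g ℓ (f^[m] a) := by rwa [Function.iterate_fixed ha]
    have hm := (hg'.comp a (hf.iterate ha m)).const_smul c
    rw [← precomp_pow_apply] at hm
    simpa [aeval_monomial, ← Algebra.smul_def] using hm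

lemma hasFDerivAt_zero_of_mem_vanishingHolomorphic {V : Type*} [NormedAddCommGroup V]
    [NormedSpace ℂ V] {B : Set V} (hB : B ∈ 𝓝 (0 : V)) {g : V → ℂ} {N : ℕ} (hN : 1 < N)
    (hg : g ∈ vanishingHolomorphic B N) : HasFDerivAt g (0 : V →L[ℂ] ℂ) 0 := by
  have hO : g =O[𝓝 0] fun z => ‖z - 0‖ ^ N := by
    simpa using hg.2.mono (Filter.le_principal_iff.2 hB)
  exact hO.hasFDerivAt hN

variable {V ι : Type*} [NormedAddCommGroup V] [NormedSpace ℂ V] [FiniteDimensional ℂ V]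
  {f : V → V} {A : V →L[ℂ] V} {B : Set V} {C q : ℝ}

lemma AdaptedBasis.coord_comp_aeval_eq_zero
    (b : AdaptedBasis (A : V →ₗ[ℂ] V) ι) (i : ι) {M : ℕ} (hM : Module.finrank ℂ V ≤ M)
    (u : ℂ[X]) :
    (LinearMap.toContinuousLinearMap (b.basis.coord i)).comp
      (aeval A (u * (X - Polynomial.C (b.ev i : ℂ)) ^ M)) = 0 := by
  ext z
  have hp := DFunLike.congr_fun (aeval_algHom_apply (Module.End.toContinuousLinearMap V)
    (A : V →ₗ[ℂ] V) ((X - Polynomial.C (b.ev i : ℂ)) ^ M * u)) z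
  rw [mul_comm]
  refine (congrArg (b.basis.coord i) hp).trans ?_
  rw [map_mul, aeval_X_sub_C_pow]
  exact LinearMap.congr_fun (b.coord_comp_pow_eq_zero i hM) (aeval (A : V →ₗ[ℂ] V) u z)

lemma IsAttractingNhd.exists_eigenCoord [Finite ι] (hB : IsAttractingNhd f B C q)
    (hfB : ∀ z, f z ∈ B) (hf : HasFDerivAt f A 0) (b : AdaptedBasis (A : V →ₗ[ℂ] V) ι) {N : ℕ}
    (hN : 1 < N) (i : ι) (hμ : q ^ N < ‖(b.ev i : ℂ)‖) :
    ∃ g ∈ vanishingHolomorphic B 1,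
      g ∈ Module.End.maxGenEigenspace (precomp ℂ f).toLinearMap (b.ev i : ℂ) ∧
      HasFDerivAt g (LinearMap.toContinuousLinearMap (b.basis.coord i)) 0 := by
  have := Fintype.ofFinite ι
  have hBn : B ∈ 𝓝 0 := hB.isOpen.mem_nhds hB.zero_mem
  have hcs := isCoordSystem_coord b.basis B
  let S : Submodule ℂ (V → ℂ) := Submodule.span ℂ
    (Set.range fun x : (Σ k : Fin N, (Fin k → ι)) => ∏ j, ⇑(b.basis.coord (x.2 j)))
  have hS : FiniteDimensional ℂ S := .span_of_finite ℂ (Set.finite_range _)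
  have hES : vanishingHolomorphic B 1 ≤ S ⊔ vanishingHolomorphic B N := by
    intro g hg
    obtain ⟨c, hc⟩ := hcs.exists_sub_sum_mem hB.isOpen hB.zero_mem hB.norm_le
      (vanishingHolomorphic_anti hB.norm_le (Nat.zero_le 1) hg) N
    refine Submodule.mem_sup.2 ⟨_, sum_mem fun x _ => ?_, _, hc, add_sub_cancel _ _⟩
    exact S.smul_mem _ (Submodule.subset_span ⟨x, rfl⟩)
  obtain ⟨M, u, hM, κ, hκ, heig⟩ := exists_sub_sub_mem_maxGenEigenspace
    (hB.vanishingHolomorphic_mem_invtSubmodule 1) (hB.vanishingHolomorphic_mem_invtSubmodule N) hES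
    (fun g hg => hB.exists_sub_smul_eq hfB hμ hg) (hcs.mem i) (Module.finrank ℂ V)
  refine ⟨_, sub_mem (sub_mem (hcs.mem i) (aeval_apply_mem
    (hB.vanishingHolomorphic_mem_invtSubmodule 1) _ (hcs.mem i)))
    (vanishingHolomorphic_anti hB.norm_le hN.le hκ), heig, ?_⟩
  have hu := hasFDerivAt_aeval_precomp hf hB.map_zero (hcs.hasFDerivAt i)
    (u * (X - Polynomial.C (b.ev i : ℂ)) ^ M)
  rw [b.coord_comp_aeval_eq_zero i hM] at hu
  simpa using ((hcs.hasFDerivAt i).sub hu).sub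
    (hasFDerivAt_zero_of_mem_vanishingHolomorphic hBn hN hκ)

end EigenCoord

section NormalForm

open Filter Set

variable {V ι : Type*} [NormedAddCommGroup V] [NormedSpace ℂ V] [FiniteDimensional ℂ V]
  {f : V → V} {A : V →L[ℂ] V} {B : Set V} {C q : ℝ}

lemma AdaptedBasis.sum_weight_eq {K V ι : Type*} [NormedField K] [AddCommGroup V] [Module K V]
    {L : Module.End K V} (b : AdaptedBasis L ι) (h0 : ∀ j : L.Eigenvalues, (j : K) ≠ 0)
    {κ : Type*} [Fintype κ] {x : κ → ι} {i : ι} (h : ∏ j, (b.ev (x j) : K) = b.ev i) :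
    ∑ j, b.weight (x j) = b.weight i := by
  simp only [AdaptedBasis.weight]
  rw [← h, norm_prod, Real.log_prod fun j _ => norm_ne_zero_iff.2 (h0 _), Finset.sum_neg_distrib]

/-- The expansion of `φ i ∘ f` in monomials `∏ φ (x j)` retains only the resonant ones, which lie in
the generalized eigenspace of `φ i`; the remainder lies there too and is too flat to be nonzero. -/
lemma IsAttractingNhd.exists_resonant_expansion [Fintype ι] (hB : IsAttractingNhd f B C q)
    {β : Module.Basis ι ℂ V} {φ : ι → V → ℂ} (hφ : IsCoordSystem β B φ) {ν : ι → ℂ} {i : ι}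
    (heig : ∀ i, φ i ∈ Module.End.maxGenEigenspace (precomp ℂ f).toLinearMap (ν i)) {N : ℕ}
    (hN : q ^ N < ‖ν i‖) [DecidableEq ℂ] :
    ∃ c : (Σ k : Fin N, (Fin k → ι)) → ℂ, ∀ z ∈ B,
      φ i (f z) = ∑ x with ∏ j, ν (x.2 j) = ν i, c x * ∏ j, φ (x.2 j) z := by
  have hTmem : (precomp ℂ f).toLinearMap (φ i) ∈ vanishingHolomorphic B 0 :=
    hB.vanishingHolomorphic_mem_invtSubmodule 0
      (vanishingHolomorphic_anti hB.norm_le (Nat.zero_le 1) (hφ.mem i))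
  have hTeig : (precomp ℂ f).toLinearMap (φ i) ∈
      Module.End.maxGenEigenspace (precomp ℂ f).toLinearMap (ν i) :=
    Module.End.mapsTo_maxGenEigenspace_of_comm (Commute.refl _) _ (heig i)
  obtain ⟨c, hc⟩ := hφ.exists_sub_sum_mem hB.isOpen hB.zero_mem hB.norm_le hTmem N
  have hmono (x : Σ k : Fin N, (Fin k → ι)) : c x • ∏ j, φ (x.2 j) ∈
      Module.End.maxGenEigenspace (precomp ℂ f).toLinearMap (∏ j, ν (x.2 j)) :=
    Submodule.smul_mem _ _ (prod_mem_maxGenEigenspace _ _ fun j _ => heig (x.2 j))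
  have hflat := sub_sum_filter_mem (hB.vanishingHolomorphic_mem_invtSubmodule N) hTeig hmono hc
  have hrem := sub_mem hTeig (sum_mem (t := Finset.univ.filter fun x : (Σ k : Fin N, (Fin k → ι)) =>
    ∏ j, ν (x.2 j) = ν i) fun x hx => (Finset.mem_filter.1 hx).2 ▸ hmono x)
  refine ⟨c, fun z hz => ?_⟩
  have hzero := hB.eqOn_zero_of_mem_maxGenEigenspace hN hflat hrem hz
  rw [Pi.sub_apply, Pi.zero_apply, sub_eq_zero] at hzero
  exact hzero.trans (by simp)

lemma IsAttractingNhd.exists_normalForm_of_forall_mem [Finite ι] (hB : IsAttractingNhd f B C q)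
    (hfB : ∀ z, f z ∈ B) (hf : HasFDerivAt f A 0) (b : AdaptedBasis (A : V →ₗ[ℂ] V) ι)
    (h0 : ∀ j : Module.End.Eigenvalues (A : V →ₗ[ℂ] V), (j : ℂ) ≠ 0) :
    ∃ φ P : V → V, P ∈ weightedMaps b.basis b.weight ∧ DifferentiableOn ℂ φ B ∧ φ 0 = 0 ∧
      HasFDerivAt φ (ContinuousLinearEquiv.refl ℂ V : V →L[ℂ] V) 0 ∧
      ∀ z ∈ B, φ (f z) = P (φ z) := by
  classical
  have := Fintype.ofFinite ι
  obtain ⟨N, hN1, hN⟩ : ∃ N, 1 < N ∧ ∀ i, q ^ N < ‖(b.ev i : ℂ)‖ := by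
    have h (i : ι) : ∀ᶠ N in atTop, q ^ N < ‖(b.ev i : ℂ)‖ :=
      (tendsto_pow_atTop_nhds_zero_of_lt_one hB.pos.le hB.lt_one).eventually_lt_const
        (norm_pos_iff.2 (h0 _))
    exact ((eventually_gt_atTop 1).and (eventually_all.2 h)).exists
  choose φ hφmem hφeig hφd using fun i => hB.exists_eigenCoord hfB hf b hN1 i (hN i)
  have hφ : IsCoordSystem b.basis B φ := ⟨hφmem, hφd⟩
  choose c hc using fun i => hB.exists_resonant_expansion hφ hφeig (hN i)
  let p (i : ι) : MvPolynomial ι ℂ := ∑ x : (Σ k : Fin N, (Fin k → ι))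
    with ∏ j, (b.ev (x.2 j) : ℂ) = b.ev i, c i x • ∏ j, MvPolynomial.X (x.2 j)
  have hp (i : ι) : p i ∈ boundedWeight ℂ b.weight (b.weight i) :=
    sum_mem fun x hx => Submodule.smul_mem _ _ (by
      rw [← b.sum_weight_eq h0 (Finset.mem_filter.1 hx).2]
      exact prod_mem_boundedWeight fun j _ => X_mem_boundedWeight _)
  refine ⟨mapOfCoords b.basis φ,
    mapOfCoords b.basis fun i z => MvPolynomial.eval (b.basis.repr z) (p i),
    fun i => ⟨p i, hp i, fun z => repr_mapOfCoords _ _ _ _⟩, hφ.differentiableOn_mapOfCoords,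
    hφ.mapOfCoords_zero hB.zero_mem, hφ.hasFDerivAt_mapOfCoords, fun z hz => ?_⟩
  refine b.basis.ext_elem fun i => ?_
  simp [p, repr_mapOfCoords, hc i z hz, MvPolynomial.smul_eval]

/-- Only the values of `f` on `B` matter, so `f` may be replaced by a map into `B`. -/
theorem IsAttractingNhd.exists_normalForm [Finite ι] (hB : IsAttractingNhd f B C q)
    (hf : HasFDerivAt f A 0) (b : AdaptedBasis (A : V →ₗ[ℂ] V) ι)
    (h0 : ∀ j : Module.End.Eigenvalues (A : V →ₗ[ℂ] V), (j : ℂ) ≠ 0) :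
    ∃ φ P : V → V, P ∈ weightedMaps b.basis b.weight ∧ DifferentiableOn ℂ φ B ∧ φ 0 = 0 ∧
      HasFDerivAt φ (ContinuousLinearEquiv.refl ℂ V : V →L[ℂ] V) 0 ∧
      ∀ z ∈ B, φ (f z) = P (φ z) := by
  have heq : EqOn f (B.indicator f) B := fun z hz => (indicator_of_mem hz f).symm
  have hd : HasFDerivAt (B.indicator f) A 0 :=
    hf.congr_of_eventuallyEq (heq.eventuallyEq_of_mem (hB.isOpen.mem_nhds hB.zero_mem)).symm
  have hmem (z : V) : B.indicator f z ∈ B := by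
    by_cases hz : z ∈ B
    · exact heq hz ▸ hB.mapsTo hz
    · exact indicator_of_notMem hz f ▸ hB.zero_mem
  obtain ⟨φ, P, hP, hφ, hφ0, hφd, hφP⟩ :=
    (hB.congr heq).exists_normalForm_of_forall_mem hmem hd b h0
  exact ⟨φ, P, hP, hφ, hφ0, hφd, fun z hz => by rw [heq hz, hφP z hz]⟩

end NormalForm

/-! ### Orbit spaces of wandering maps -/

section OrbitSpace

open Filter Set

variable {X : Type*} {f : X → X} {x y : X}

/-- The orbit space of a self-map `f`: the quotient by the equivalence relation generated by
`x ∼ f x`. -/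
abbrev OrbitSpace (f : X → X) : Type _ := Quot fun x y => y = f x

/-- The projection onto the orbit space. -/
abbrev orbitMk (f : X → X) (x : X) : OrbitSpace f := Quot.mk _ x

lemma orbitMk_iterate (f : X → X) (k : ℕ) (x : X) : orbitMk f (f^[k] x) = orbitMk f x := by
  induction k with
  | zero => rfl
  | succ k ih =>
    rw [Function.iterate_succ_apply', ← ih]
    exact (Quot.sound (r := fun x y => y = f x) rfl).symm

lemma exists_iterate_eq_iterate_of_orbitMk_eq (h : orbitMk f x = orbitMk f y) :
    ∃ a b, f^[a] x = f^[b] y := by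
  replace h := Quot.eqvGen_exact h
  induction h with
  | rel x y h => exact ⟨1, 0, h.symm⟩
  | refl x => exact ⟨0, 0, rfl⟩
  | symm x y _ ih =>
    obtain ⟨a, b, hab⟩ := ih
    exact ⟨b, a, hab.symm⟩
  | trans x y z _ _ ih₁ ih₂ =>
    obtain ⟨a, b, hab⟩ := ih₁
    obtain ⟨c, d, hcd⟩ := ih₂
    refine ⟨c + a, b + d, ?_⟩
    rw [Function.iterate_add_apply, hab, ← Function.iterate_add_apply, add_comm c b,
      Function.iterate_add_apply, hcd, ← Function.iterate_add_apply]

lemma orbitMk_eq_iff (hinj : Function.Injective f) :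
    orbitMk f x = orbitMk f y ↔ ∃ k, f^[k] x = y ∨ f^[k] y = x := by
  refine ⟨fun h => ?_, ?_⟩
  · obtain ⟨a, b, h⟩ := exists_iterate_eq_iterate_of_orbitMk_eq h
    rcases le_total a b with hab | hab <;> obtain ⟨c, rfl⟩ := Nat.exists_eq_add_of_le hab <;>
      rw [Function.iterate_add_apply] at h
    · exact ⟨c, Or.inr (hinj.iterate a h).symm⟩
    · exact ⟨c, Or.inl (hinj.iterate b h)⟩
  · rintro ⟨k, rfl | rfl⟩
    · exact (orbitMk_iterate f k x).symm
    · exact orbitMk_iterate f k y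

lemma preimage_orbitMk_image (hinj : Function.Injective f) (O : Set X) :
    orbitMk f ⁻¹' (orbitMk f '' O) = ⋃ k, (f^[k] '' O ∪ f^[k] ⁻¹' O) := by
  ext y
  simp only [mem_preimage, mem_image, orbitMk_eq_iff hinj, mem_iUnion, mem_union]
  constructor
  · rintro ⟨x, hx, k, h | h⟩
    · exact ⟨k, Or.inl ⟨x, hx, h⟩⟩
    · exact ⟨k, Or.inr (h ▸ hx)⟩
  · rintro ⟨k, ⟨x, hx, h⟩ | h⟩
    · exact ⟨x, hx, k, Or.inl h⟩
    · exact ⟨_, h, k, Or.inr rfl⟩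

variable [TopologicalSpace X]

lemma isOpenMap_iterate (hopen : IsOpenMap f) (k : ℕ) : IsOpenMap f^[k] := by
  induction k with
  | zero => exact IsOpenMap.id
  | succ k ih => exact Function.iterate_succ f k ▸ ih.comp hopen

lemma isOpenQuotientMap_orbitMk (hinj : Function.Injective f) (hcont : Continuous f)
    (hopen : IsOpenMap f) : IsOpenQuotientMap (orbitMk f) := by
  refine ⟨Quot.mk_surjective, continuous_quot_mk, fun O hO => ?_⟩
  rw [isOpen_coinduced, preimage_orbitMk_image hinj]
  exact isOpen_iUnion fun k =>
    (isOpenMap_iterate hopen k O hO).union (hO.preimage (hcont.iterate k))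

/-- `f` is wandering if any two points, equal or not, have neighbourhoods such that no late iterate
of `f` maps a point of the first to a point of the second. -/
def IsWandering (f : X → X) : Prop :=
  ∀ x y : X, ∃ k₀ : ℕ, ∀ᶠ p in 𝓝 (x, y), ∀ k ≥ k₀, f^[k] p.1 ≠ p.2

lemma eventually_iterate_ne [T2Space X] (hcont : Continuous f) {k : ℕ} (h : f^[k] x ≠ y) :
    ∀ᶠ p in 𝓝 (x, y), f^[k] p.1 ≠ p.2 :=
  (isOpen_ne_fun ((hcont.iterate k).comp continuous_fst) continuous_snd).mem_nhds h

namespace IsWandering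

lemma eventually_forall_iterate_ne [T2Space X] (hf : IsWandering f) (hcont : Continuous f)
    {S : Set ℕ} (hS : ∀ k ∈ S, f^[k] x ≠ y) : ∀ᶠ p in 𝓝 (x, y), ∀ k ∈ S, f^[k] p.1 ≠ p.2 := by
  obtain ⟨k₀, hlate⟩ := hf x y
  have hearly : ∀ᶠ p in 𝓝 (x, y), ∀ k ∈ S ∩ Iio k₀, f^[k] p.1 ≠ p.2 :=
    (eventually_all_finite ((finite_Iio k₀).inter_of_right S)).2 fun k hk =>
      eventually_iterate_ne hcont (hS k hk.1)
  filter_upwards [hlate, hearly] with p hp hp' k hk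
  exact (lt_or_ge k k₀).elim (fun h => hp' k ⟨hk, h⟩) (hp k)

lemma t2Space_orbitSpace [T2Space X] (hf : IsWandering f) (hinj : Function.Injective f)
    (hcont : Continuous f) (hopen : IsOpenMap f) : T2Space (OrbitSpace f) := by
  rw [t2Space_iff_of_isOpenQuotientMap (isOpenQuotientMap_orbitMk hinj hcont hopen),
    ← isOpen_compl_iff, isOpen_iff_mem_nhds]
  rintro ⟨x, y⟩ hxy
  simp only [mem_compl_iff, mem_ofPred_eq, orbitMk_eq_iff hinj, not_exists, not_or] at hxy
  have hxy₁ := hf.eventually_forall_iterate_ne hcont (S := univ) fun k _ => (hxy k).1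
  have hxy₂ := hf.eventually_forall_iterate_ne hcont (S := univ) fun k _ => (hxy k).2
  filter_upwards [hxy₁, (continuous_swap.tendsto (x, y)).eventually hxy₂] with p hp hp'
  simp only [mem_compl_iff, mem_ofPred_eq, orbitMk_eq_iff hinj, not_exists, not_or]
  exact fun k => ⟨hp k trivial, hp' k trivial⟩

lemma iterate_ne (hf : IsWandering f) {k : ℕ} (hk : 0 < k) (x : X) : f^[k] x ≠ x := by
  intro h
  obtain ⟨k₀, hk₀⟩ := hf x x
  refine hk₀.self_of_nhds (k * k₀) (Nat.le_mul_of_pos_left k₀ hk) ?_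
  rw [Function.iterate_mul]
  exact Function.iterate_fixed h k₀

lemma exists_isOpen_injOn_orbitMk [T2Space X] (hf : IsWandering f) (hinj : Function.Injective f)
    (hcont : Continuous f) (x : X) : ∃ O, IsOpen O ∧ x ∈ O ∧ InjOn (orbitMk f) O := by
  have h := hf.eventually_forall_iterate_ne hcont (S := Ioi 0) fun k hk => hf.iterate_ne hk x
  rw [nhds_prod_eq, eventually_prod_self_iff
    (r := fun y z => ∀ k ∈ Ioi 0, f^[k] y ≠ z)] at h
  obtain ⟨t, ht, h⟩ := h
  obtain ⟨O, hOt, hO, hxO⟩ := mem_nhds_iff.1 ht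
  refine ⟨O, hO, hxO, fun y hy z hz hyz => ?_⟩
  obtain ⟨k, hk⟩ := (orbitMk_eq_iff hinj).1 hyz
  rcases Nat.eq_zero_or_pos k with rfl | hpos
  · exact hk.elim id Eq.symm
  · exact hk.elim (fun hk => absurd hk (h y (hOt hy) z (hOt hz) k hpos))
      fun hk => absurd hk (h z (hOt hz) y (hOt hy) k hpos)

lemma isLocalHomeomorph_orbitMk [T2Space X] (hf : IsWandering f)
    (hinj : Function.Injective f) (hcont : Continuous f) (hopen : IsOpenMap f) :
    IsLocalHomeomorph (orbitMk f) := by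
  have hq := isOpenQuotientMap_orbitMk hinj hcont hopen
  refine isLocalHomeomorph_iff_isOpenEmbedding_restrict.2 fun x => ?_
  obtain ⟨O, hO, hxO, hinjO⟩ := hf.exists_isOpen_injOn_orbitMk hinj hcont x
  exact ⟨O, hO.mem_nhds hxO, .of_continuous_injective_isOpenMap
    (hq.continuous.comp continuous_subtype_val) (injOn_iff_injective.1 hinjO)
    (hq.isOpenMap.comp hO.isOpenMap_subtype_val)⟩

lemma eventually_iterate_eq [T2Space X] (hf : IsWandering f) (hinj : Function.Injective f)
    (hcont : Continuous f) (x : X) (k : ℕ) :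
    ∀ᶠ p in 𝓝 (x, f^[k] x), orbitMk f p.1 = orbitMk f p.2 → f^[k] p.1 = p.2 := by
  obtain ⟨O, hO, hyO, hinjO⟩ := hf.exists_isOpen_injOn_orbitMk hinj hcont (f^[k] x)
  filter_upwards [(((hcont.iterate k).comp continuous_fst).tendsto (x, f^[k] x)).eventually
    (hO.mem_nhds hyO), (continuous_snd.tendsto (x, f^[k] x)).eventually (hO.mem_nhds hyO)]
    with p hp₁ hp₂ hp
  exact hinjO hp₁ hp₂ ((orbitMk_iterate f k p.1).trans hp)

end IsWandering

end OrbitSpace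

/-! ### Basin of attraction -/

section Basin

open Filter Set Metric

/-- The set of points of `U` whose `f`-orbit enters `B`. -/
def basin {X : Type*} (f : X → X) (U B : Set X) : Set X := {z ∈ U | ∃ k, f^[k] z ∈ B}

lemma eventually_iterate_mem {X : Type*} [TopologicalSpace X] {f : X → X} {U B : Set X} {x : X}
    (hU : IsOpen U) (hf : ContinuousOn f U) (hfU : MapsTo f U U)
    (hB : IsOpen B) (hx : x ∈ U) {k : ℕ} (hk : f^[k] x ∈ B) :
    ∀ᶠ y in 𝓝 x, y ∈ U ∧ f^[k] y ∈ B :=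
  ((hf.iterate hfU k).isOpen_inter_preimage hU hB).mem_nhds ⟨hx, hk⟩

lemma isOpen_basin {X : Type*} [TopologicalSpace X] {f : X → X} {U B : Set X}
    (hU : IsOpen U) (hf : ContinuousOn f U) (hfU : MapsTo f U U) (hB : IsOpen B) :
    IsOpen (basin f U B) := by
  refine isOpen_iff_mem_nhds.2 fun x ⟨hx, k, hk⟩ => ?_
  exact (eventually_iterate_mem hU hf hfU hB hx hk).mono fun y hy => ⟨hy.1, k, hy.2⟩

variable {V : Type*} [NormedAddCommGroup V] [NormedSpace ℂ V]
  {f : V → V} {U B : Set V} {C q ε : ℝ} {z : V}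

lemma IsAttractingNhd.exists_norm_iterate_lt (hB : IsAttractingNhd f B C q) (hε : 0 < ε) :
    ∃ k₀, ∀ k ≥ k₀, ∀ z ∈ B, ‖f^[k] z‖ < ε := by
  have hlim : Tendsto (fun k : ℕ => |C| * q ^ k) atTop (𝓝 0) := by
    simpa using (tendsto_pow_atTop_nhds_zero_of_lt_one hB.pos.le hB.lt_one).const_mul |C|
  obtain ⟨k₀, hk₀⟩ := eventually_atTop.1 (hlim.eventually_lt_const hε)
  have hq := hB.pos
  refine ⟨k₀, fun k hk z hz => lt_of_le_of_lt ?_ (hk₀ k hk)⟩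
  calc ‖f^[k] z‖ ≤ C * q ^ k * ‖z‖ := hB.norm_iterate_le k z hz
    _ ≤ |C| * q ^ k * 1 := by
      gcongr
      · exact le_abs_self C
      · exact hB.norm_le z hz
    _ = |C| * q ^ k := mul_one _

/-- The iterates of `f` are uniformly bounded on `U`, hence equicontinuous, by the Schwarz lemma. -/
lemma exists_dist_iterate_succ_le (hU : IsOpen U) (hf : DifferentiableOn ℂ f U)
    (hfU : MapsTo f U U) (hbdd : Bornology.IsBounded (f '' U)) (hz : z ∈ U) :
    ∃ K, ∀ᶠ w in 𝓝 z, ∀ k, dist (f^[k + 1] w) (f^[k + 1] z) ≤ K * dist w z := by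
  obtain ⟨r, hr, hball⟩ := Metric.mem_nhds_iff.1 (hU.mem_nhds hz)
  have himage : ∀ k, ∀ w ∈ U, f^[k + 1] w ∈ f '' U := fun k w hw =>
    ⟨f^[k] w, hfU.iterate k hw, (Function.iterate_succ_apply' f k w).symm⟩
  refine ⟨Metric.diam (f '' U) / r, ?_⟩
  filter_upwards [ball_mem_nhds z hr] with w hw k
  exact Complex.dist_le_div_mul_dist_of_mapsTo_ball ((hf.iterate hfU (k + 1)).mono hball)
    (fun y hy => Metric.dist_le_diam_of_mem hbdd (himage k y (hball hy)) (himage k z hz)) hw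

lemma IsAttractingNhd.closure_basin_inter_subset (hB : IsAttractingNhd f B C q) (hU : IsOpen U)
    (hf : DifferentiableOn ℂ f U) (hfU : MapsTo f U U) (hbdd : Bornology.IsBounded (f '' U)) :
    closure (basin f U B) ∩ U ⊆ basin f U B := by
  rintro z ⟨hcl, hz⟩
  obtain ⟨ε, hε, hball⟩ := Metric.mem_nhds_iff.1 (hB.isOpen.mem_nhds hB.zero_mem)
  obtain ⟨K, hK⟩ := exists_dist_iterate_succ_le hU hf hfU hbdd hz
  have hsmall : ∀ᶠ w in 𝓝 z, K * dist w z < ε / 2 := by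
    refine ContinuousAt.eventually_lt (by fun_prop) continuousAt_const ?_
    simpa using half_pos hε
  obtain ⟨w, ⟨-, k₁, hk₁⟩, hdist, hw⟩ :=
    ((mem_closure_iff_frequently.1 hcl).and_eventually (hK.and hsmall)).exists
  obtain ⟨k₀, hk₀⟩ := hB.exists_norm_iterate_lt (half_pos hε)
  have hwk : ‖f^[k₀ + k₁ + 1] w‖ < ε / 2 := by
    have h := hk₀ (k₀ + 1) k₀.le_succ _ hk₁
    rwa [← Function.iterate_add_apply, add_right_comm] at h
  refine ⟨hz, k₀ + k₁ + 1, hball (mem_ball_zero_iff.2 ?_)⟩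
  calc ‖f^[k₀ + k₁ + 1] z‖ = dist (f^[k₀ + k₁ + 1] z) 0 := (dist_zero_right _).symm
    _ ≤ dist (f^[k₀ + k₁ + 1] w) (f^[k₀ + k₁ + 1] z) + dist (f^[k₀ + k₁ + 1] w) 0 :=
      dist_triangle_left _ _ _
    _ < ε / 2 + ε / 2 :=
      add_lt_add ((hdist _).trans_lt hw) (by rwa [dist_zero_right])
    _ = ε := add_halves ε

lemma IsAttractingNhd.connectedComponentIn_subset_basin (hB : IsAttractingNhd f B C q)
    (hU : IsOpen U) (h0 : 0 ∈ U) (hf : DifferentiableOn ℂ f U) (hfU : MapsTo f U U)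
    (hbdd : Bornology.IsBounded (f '' U)) : connectedComponentIn U 0 ⊆ basin f U B := by
  refine isPreconnected_connectedComponentIn.subset_of_closure_inter_subset
    (isOpen_basin hU hf.continuousOn hfU hB.isOpen)
    ⟨0, mem_connectedComponentIn h0, h0, 0, hB.zero_mem⟩ fun z hz => ?_
  exact hB.closure_basin_inter_subset hU hf hfU hbdd ⟨hz.1, connectedComponentIn_subset U 0 hz.2⟩

end Basin

section HopfDynamics

open Filter Set

variable {n : ℕ} {F : OpenPartialHomeomorph (Cn n) (Cn n)} {B : Set (Cn n)} {C q : ℝ}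

namespace IsHopfContraction

lemma mapsTo (hF : IsHopfContraction F) : MapsTo F F.source F.source := fun _ hz =>
  hF.closure_subset (subset_closure (F.map_source hz))

lemma isBounded_image (hF : IsHopfContraction F) : Bornology.IsBounded (F '' F.source) :=
  F.image_source_eq_target ▸ hF.isCompact_closure.isBounded.subset subset_closure

lemma spectralRadius_lt_one (hF : IsHopfContraction F) : spectralRadius ℂ (fderiv ℂ F 0) < 1 :=
  spectralRadius_lt_one_of_hasEigenvalue hF.contracting

lemma hasFDerivAt_zero (hF : IsHopfContraction F) : HasFDerivAt F (fderiv ℂ F 0) 0 :=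
  (hF.holomorphic.differentiableAt (F.open_source.mem_nhds hF.zero_mem)).hasFDerivAt

lemma eigenvalue_ne_zero (hF : IsHopfContraction F) (j : (linearPart F).Eigenvalues) :
    (j : ℂ) ≠ 0 := by
  intro hj
  obtain ⟨v, hv⟩ := Module.End.HasEigenvalue.exists_hasEigenvector
    (f := linearPart F) (μ := (j : ℂ)) j.2
  have hv0 : fderiv ℂ F 0 v = 0 := hv.apply_eq_smul.trans (by rw [hj, zero_smul])
  have hinj : Function.Injective (fderiv ℂ F 0) := (leftInverse_fderiv
    hF.hasFDerivAt_zero.differentiableAt (hF.holomorphic_symm.differentiableAt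
      (F.open_target.mem_nhds (F.map_source hF.zero_mem)))
    (F.eventually_left_inverse hF.zero_mem)).injective
  exact hv.2 (hinj (hv0.trans (_root_.map_zero _).symm))

lemma exists_iterate_mem (hF : IsHopfContraction F) (hB : IsAttractingNhd F B C q) {z : Cn n}
    (hz : z ∈ F.source) : ∃ k, F^[k] z ∈ B := by
  obtain ⟨k, hk⟩ := hF.orbit_mem_component z hz
  obtain ⟨-, l, hl⟩ := hB.connectedComponentIn_subset_basin F.open_source hF.zero_mem
    hF.holomorphic hF.mapsTo hF.isBounded_image hk
  exact ⟨l + k, by rwa [Function.iterate_add_apply]⟩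

theorem exists_eventually_norm_iterate_lt (hF : IsHopfContraction F) {z : Cn n} (hz : z ∈ F.source)
    {ε : ℝ} (hε : 0 < ε) : ∃ k₀, ∀ᶠ w in 𝓝 z, ∀ k ≥ k₀, ‖F^[k] w‖ < ε := by
  obtain ⟨B, C, q, -, hB⟩ := exists_isAttractingNhd F.open_source hF.zero_mem hF.holomorphic
    hF.map_zero hF.spectralRadius_lt_one
  obtain ⟨k₁, hk₁⟩ := hF.exists_iterate_mem hB hz
  obtain ⟨k₂, hk₂⟩ := hB.exists_norm_iterate_lt hε
  refine ⟨k₂ + k₁, ?_⟩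
  filter_upwards [eventually_iterate_mem F.open_source hF.holomorphic.continuousOn hF.mapsTo
    hB.isOpen hz hk₁] with w hw k hk
  have h := hk₂ (k - k₁) (by omega) _ hw.2
  rwa [← Function.iterate_add_apply, Nat.sub_add_cancel (by omega)] at h

end IsHopfContraction

end HopfDynamics

/-! ### Structure groupoids -/

section StructureGroupoid

open Filter Set

variable {H : Type*} [TopologicalSpace H] {𝒢 : StructureGroupoid H} [ClosedUnderRestriction 𝒢]

lemma exists_mem_groupoid_coe_eq_iterate {e : OpenPartialHomeomorph H H} (he : e ∈ 𝒢)
    (hmaps : MapsTo e e.source e.source) (k : ℕ) :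
    ∃ e' ∈ 𝒢, e'.source = e.source ∧ ⇑e' = e^[k] := by
  induction k with
  | zero =>
    exact ⟨.ofSet e.source e.open_source, (closedUnderRestriction_iff_id_le 𝒢).1 inferInstance
      (idRestrGroupoid_mem e.open_source), rfl, rfl⟩
  | succ k ih =>
    obtain ⟨e', he', hs, hk⟩ := ih
    refine ⟨e.trans e', 𝒢.trans he he', ?_, ?_⟩
    · rw [OpenPartialHomeomorph.trans_source, hs, inter_eq_left]
      exact hmaps
    · rw [OpenPartialHomeomorph.coe_trans, hk, Function.iterate_succ]

lemma exists_openPartialHomeomorph_of_injOn [Nonempty H] {ψ : H → H} {U : Set H} (hU : IsOpen U)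
    (hinj : InjOn ψ U)
    (hloc : ∀ x ∈ U, ∃ e : OpenPartialHomeomorph H H, x ∈ e.source ∧ EqOn ψ e e.source) :
    ∃ Ψ : OpenPartialHomeomorph H H, Ψ.source = U ∧ ⇑Ψ = ψ := by
  have hnhds : ∀ x ∈ U, map ψ (𝓝 x) = 𝓝 (ψ x) := fun x hx => by
    obtain ⟨e, hxe, he⟩ := hloc x hx
    rw [map_congr (he.eventuallyEq_of_mem (e.open_source.mem_nhds hxe)), e.map_nhds_eq hxe, he hxe]
  have hcont : ContinuousOn ψ U := fun x hx =>
    ContinuousAt.continuousWithinAt (hnhds x hx).le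
  have hopen : IsOpenMap (U.domRestrict ψ) := isOpenMap_iff_nhds_le.2 fun ⟨x, hx⟩ => by
    change 𝓝 (ψ x) ≤ map (ψ ∘ Subtype.val) _
    rw [← map_map, map_nhds_subtype_coe_eq_nhds hx (hU.mem_nhds hx), hnhds x hx]
  exact ⟨.ofContinuousOpenRestrict (hinj.toPartialEquiv ψ U) hcont hopen hU, rfl, rfl⟩

lemma exists_mem_groupoid_of_injOn [Nonempty H] {ψ : H → H} {U : Set H} (hU : IsOpen U)
    (hinj : InjOn ψ U) (hloc : ∀ x ∈ U, ∃ e ∈ 𝒢, x ∈ e.source ∧ EqOn ψ e e.source) :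
    ∃ Ψ ∈ 𝒢, Ψ.source = U ∧ ⇑Ψ = ψ := by
  obtain ⟨Ψ, rfl, rfl⟩ := exists_openPartialHomeomorph_of_injOn hU hinj fun x hx =>
    let ⟨e, _, h⟩ := hloc x hx; ⟨e, h⟩
  refine ⟨Ψ, 𝒢.locality fun x hx => ?_, rfl, rfl⟩
  obtain ⟨e, heG, hxe, he⟩ := hloc x hx
  refine ⟨e.source, e.open_source, hxe, 𝒢.mem_of_eqOnSource
    (closedUnderRestriction' heG Ψ.open_source) ⟨?_, fun y hy => ?_⟩⟩
  · simp only [OpenPartialHomeomorph.restr_source, e.open_source.interior_eq,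
      Ψ.open_source.interior_eq, inter_comm]
  · rw [OpenPartialHomeomorph.restr_source, e.open_source.interior_eq] at hy
    exact he hy.2

variable {𝕜 E : Type*} [NormedAddCommGroup E]

lemma mem_contDiffGroupoid_self_iff [NontriviallyNormedField 𝕜] [NormedSpace 𝕜 E]
    {e : OpenPartialHomeomorph E E} {k : WithTop ℕ∞} : e ∈ contDiffGroupoid k 𝓘(𝕜, E) ↔
      ContDiffOn 𝕜 k e e.source ∧ ContDiffOn 𝕜 k e.symm e.target := by
  rw [contDiffGroupoid, mem_groupoid_of_pregroupoid]
  simp [contDiffPregroupoid]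

lemma exists_mem_contDiffGroupoid_coe_eq [NontriviallyNormedField 𝕜] [NormedSpace 𝕜 E]
    {g : Equiv.Perm E} {k : WithTop ℕ∞} (hg : ContDiff 𝕜 k g) (hg' : ContDiff 𝕜 k g.symm) :
    ∃ e ∈ contDiffGroupoid k 𝓘(𝕜, E), e.source = univ ∧ ⇑e = g :=
  ⟨(Homeomorph.mk g hg.continuous hg'.continuous).toOpenPartialHomeomorph,
    mem_contDiffGroupoid_self_iff.2 ⟨hg.contDiffOn, hg'.contDiffOn⟩, rfl, rfl⟩

lemma exists_mem_contDiffGroupoid_of_hasFDerivAt [RCLike 𝕜] [NormedSpace 𝕜 E] [CompleteSpace E]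
    {φ : E → E} {a : E} (hφ : ContDiffAt 𝕜 ω φ a) {φ' : E ≃L[𝕜] E}
    (hφ' : HasFDerivAt φ (φ' : E →L[𝕜] E) a) :
    ∃ e ∈ contDiffGroupoid ω 𝓘(𝕜, E), a ∈ e.source ∧ ⇑e = φ := by
  let e := hφ.toOpenPartialHomeomorph φ hφ' (by simp)
  have ha : a ∈ e.source := hφ.mem_toOpenPartialHomeomorph_source hφ' (by simp)
  refine ⟨e.restrContDiff 𝕜 ω (by simp), mem_contDiffGroupoid_self_iff.2
    ⟨e.contDiffOn_restrContDiff_source 𝕜 _, e.contDiffOn_restrContDiff_target 𝕜 _⟩,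
    ⟨ha, hφ, ?_⟩, rfl⟩
  exact e.contDiffAt_symm (e.map_source ha) (f₀' := φ') (by rwa [e.left_inv ha])
    (by rwa [e.left_inv ha])

end StructureGroupoid

/-! ### The developing map of a Hopf contraction -/

section DevelopingMap

open Filter Set

section Semiconj

variable {X Y : Type*} {f : X → X} {g : Equiv.Perm Y} {φ ψ : X → Y} {U B : Set X}

lemma semiconj_iterate (hB : MapsTo f B B) (hφ : ∀ x ∈ B, φ (f x) = g (φ x)) {x : X} (hx : x ∈ B)
    (k : ℕ) : φ (f^[k] x) = (g ^ k) (φ x) := by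
  induction k with
  | zero => rfl
  | succ k ih =>
    rw [Function.iterate_succ_apply', hφ _ (hB.iterate k hx), ih, pow_succ', Equiv.Perm.mul_apply]

/-- The extension of `φ` is `g⁻ᵏ ∘ φ ∘ fᵏ` on the points that `fᵏ` maps into `B`. -/
lemma exists_extension_of_semiconj (hB : MapsTo f B B) (hφ : ∀ x ∈ B, φ (f x) = g (φ x))
    (hU : ∀ x ∈ U, ∃ k, f^[k] x ∈ B) :
    ∃ ψ : X → Y, ∀ x ∈ U, ∀ k, f^[k] x ∈ B → (g ^ k) (ψ x) = φ (f^[k] x) := by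
  classical
  choose! κ hκ using hU
  refine ⟨fun x => (g ^ κ x)⁻¹ (φ (f^[κ x] x)), fun x hx k hk => ?_⟩
  rw [← Equiv.Perm.eq_inv_iff_eq]
  have hindep : ∀ a b, a ≤ b → f^[a] x ∈ B →
      (g ^ a)⁻¹ (φ (f^[a] x)) = (g ^ b)⁻¹ (φ (f^[b] x)) := fun a b hab ha => by
    obtain ⟨c, rfl⟩ := Nat.exists_eq_add_of_le' hab
    rw [Function.iterate_add_apply, semiconj_iterate hB hφ ha, pow_add, mul_inv_rev,
      Equiv.Perm.mul_apply]
    exact congrArg _ ((g ^ c).symm_apply_apply _).symm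
  exact (le_total (κ x) k).elim (hindep _ _ · (hκ x hx)) fun h => (hindep _ _ h hk).symm

lemma extension_semiconj (hfU : MapsTo f U U) (hB : MapsTo f B B) (hU : ∀ x ∈ U, ∃ k, f^[k] x ∈ B)
    (hψ : ∀ x ∈ U, ∀ k, f^[k] x ∈ B → (g ^ k) (ψ x) = φ (f^[k] x)) {x : X} (hx : x ∈ U) :
    ψ (f x) = g (ψ x) := by
  obtain ⟨k, hk⟩ := hU x hx
  have hk' : f^[k + 1] x ∈ B := (Function.iterate_succ_apply' f k x).symm ▸ hB hk
  refine (g ^ k).injective ?_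
  rw [hψ (f x) (hfU hx) k hk', ← Function.iterate_succ_apply, ← hψ x hx (k + 1) hk', pow_succ,
    Equiv.Perm.mul_apply]

lemma injOn_extension (hfU : MapsTo f U U) (hB : MapsTo f B B) (hU : ∀ x ∈ U, ∃ k, f^[k] x ∈ B)
    (hψ : ∀ x ∈ U, ∀ k, f^[k] x ∈ B → (g ^ k) (ψ x) = φ (f^[k] x)) (hf : InjOn f U)
    (hφ : InjOn φ B) : InjOn ψ U := by
  intro x hx y hy hxy
  obtain ⟨k, hk⟩ := hU x hx
  obtain ⟨l, hl⟩ := hU y hy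
  have hx' : f^[k + l] x ∈ B := by
    rw [add_comm, Function.iterate_add_apply]
    exact hB.iterate l hk
  have hy' : f^[k + l] y ∈ B := by
    rw [Function.iterate_add_apply]
    exact hB.iterate k hl
  refine hf.iterate hfU (k + l) hx hy (hφ hx' hy' ?_)
  rw [← hψ x hx _ hx', ← hψ y hy _ hy', hxy]

end Semiconj

lemma IsCompositionMonoid.exists_perm_of_range_mem_nhds {𝕜 E : Type*} [RCLike 𝕜]
    [NormedAddCommGroup E] [NormedSpace 𝕜 E] {V : Submodule 𝕜 (E → E)}
    (hV : IsCompositionMonoid V) {Q : E → E} (hQ : Q ∈ V) {y : E} (hy : range Q ∈ 𝓝 y) :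
    ∃ g : Equiv.Perm E, ⇑g = Q := by
  have : NormedSpace ℝ E := .restrictScalars ℝ 𝕜 E
  obtain ⟨g, hg, -⟩ := hV.exists_perm hQ fun A hA hAQ => by
    have hzero : A =ᶠ[𝓝 y] 0 := by
      filter_upwards [hy]
      rintro _ ⟨z, rfl⟩
      exact hAQ z
    exact AnalyticOnNhd.eq_of_eventuallyEq (𝕜 := 𝕜)
      (fun z _ => (hV.contDiff A hA).contDiffAt.analyticAt) (fun _ _ => analyticAt_const) hzero
  exact ⟨g, hg⟩

variable {n : ℕ} {F : OpenPartialHomeomorph (Cn n) (Cn n)}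

namespace IsHopfContraction

lemma mem_contDiffGroupoid (hF : IsHopfContraction F) : F ∈ contDiffGroupoid ω 𝓘(ℂ, Cn n) :=
  mem_contDiffGroupoid_self_iff.2
    ⟨(analyticOnNhd_of_differentiableOn F.open_source hF.holomorphic).contDiffOn
        F.open_source.uniqueDiffOn,
      (analyticOnNhd_of_differentiableOn F.open_target hF.holomorphic_symm).contDiffOn
        F.open_target.uniqueDiffOn⟩

lemma weight_pos (hF : IsHopfContraction F) {ι : Type*} (b : AdaptedBasis (linearPart F) ι)
    (k : ι) : 0 < b.weight k :=
  b.weight_pos hF.eigenvalue_ne_zero (fun j => hF.contracting j j.2) k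

lemma contDiff_of_mem (hF : IsHopfContraction F) {g : Equiv.Perm (Cn n)}
    (hg : g ∈ subResonantAffineGroup (linearPart F)) : ContDiff ℂ ω g := by
  obtain ⟨b⟩ := exists_adaptedBasis (linearPart F)
  rw [subResonantAffineGroup_eq_permGroup (hF.weight_pos b)] at hg
  exact (isCompositionMonoid_weightedMaps (hF.weight_pos b)).contDiff _ hg

theorem exists_local_conj (hF : IsHopfContraction F) :
    ∃ B C q, IsAttractingNhd F B C q ∧ ∃ e ∈ contDiffGroupoid ω 𝓘(ℂ, Cn n), e.source = B ∧
      ∃ g ∈ subResonantAffineGroup (linearPart F), ∀ z ∈ B, e (F z) = g (e z) := by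
  obtain ⟨b⟩ := exists_adaptedBasis (linearPart F)
  obtain ⟨B₀, C₀, q₀, hBF, hB₀⟩ := exists_isAttractingNhd F.open_source hF.zero_mem hF.holomorphic
    hF.map_zero hF.spectralRadius_lt_one
  obtain ⟨φ, P, hP, hφ, -, hφ', hconj⟩ :=
    hB₀.exists_normalForm hF.hasFDerivAt_zero b hF.eigenvalue_ne_zero
  obtain ⟨e, he, h0e, rfl⟩ := exists_mem_contDiffGroupoid_of_hasFDerivAt
    (analyticOnNhd_of_differentiableOn hB₀.isOpen hφ 0 hB₀.zero_mem).contDiffAt hφ'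
  obtain ⟨B, C, q, hBe, hB⟩ := exists_isAttractingNhd (hB₀.isOpen.inter e.open_source)
    ⟨hB₀.zero_mem, h0e⟩ (hB₀.differentiableOn.mono inter_subset_left) hF.map_zero
    hF.spectralRadius_lt_one
  have hconjB : ∀ z ∈ B, e (F z) = P (e z) := fun z hz => hconj z (hBe hz).1
  have hrange : range P ∈ 𝓝 (e (F 0)) := by
    have hopen : IsOpen (e '' (F '' B)) := e.isOpen_image_of_subset_source
      (F.isOpen_image_of_subset_source hB.isOpen fun z hz => hBF (hBe hz).1)
      (hB.mapsTo.image_subset.trans fun z hz => (hBe hz).2)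
    refine mem_of_superset
      (hopen.mem_nhds (mem_image_of_mem e (mem_image_of_mem F hB.zero_mem))) ?_
    rintro _ ⟨_, ⟨z, hz, rfl⟩, rfl⟩
    exact ⟨e z, (hconjB z hz).symm⟩
  obtain ⟨g, rfl⟩ := (isCompositionMonoid_weightedMaps
    (hF.weight_pos b)).exists_perm_of_range_mem_nhds hP hrange
  refine ⟨B, C, q, hB, e.restr B, closedUnderRestriction' he hB.isOpen, ?_, g, ?_, hconjB⟩
  · rw [OpenPartialHomeomorph.restr_source, hB.isOpen.interior_eq, inter_eq_right]
    exact fun z hz => (hBe hz).2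
  · rw [subResonantAffineGroup_eq_permGroup (hF.weight_pos b)]
    exact hP

theorem exists_developingMap (hF : IsHopfContraction F) :
    ∃ g ∈ subResonantAffineGroup (linearPart F), ∃ Ψ ∈ contDiffGroupoid ω 𝓘(ℂ, Cn n),
      Ψ.source = F.source ∧ ∀ z ∈ F.source, Ψ (F z) = g (Ψ z) := by
  obtain ⟨B, C, q, hB, e, he, rfl, g, hg, hconj⟩ := hF.exists_local_conj
  have hU := fun z hz => hF.exists_iterate_mem hB (z := z) hz
  obtain ⟨ψ, hψ⟩ := exists_extension_of_semiconj hB.mapsTo hconj hU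
  have hinj : InjOn ψ F.source := injOn_extension hF.mapsTo hB.mapsTo hU hψ F.injOn e.injOn
  have hloc : ∀ z ∈ F.source, ∃ e' ∈ contDiffGroupoid ω 𝓘(ℂ, Cn n),
      z ∈ e'.source ∧ EqOn ψ e' e'.source := fun z hz => by
    obtain ⟨k, hk⟩ := hU z hz
    obtain ⟨Fk, hFk, hsource, hcoe⟩ :=
      exists_mem_groupoid_coe_eq_iterate hF.mem_contDiffGroupoid hF.mapsTo k
    have hgk := (subResonantAffineGroup (linearPart F)).pow_mem hg k
    obtain ⟨γ, hγ, hγs, hγk⟩ := exists_mem_contDiffGroupoid_coe_eq (g := (g ^ k)⁻¹)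
      (hF.contDiff_of_mem (Subgroup.inv_mem _ hgk)) (hF.contDiff_of_mem hgk)
    refine ⟨(Fk.trans e).trans γ, StructureGroupoid.trans _ (StructureGroupoid.trans _ hFk he) hγ,
      ?_, fun y hy => ?_⟩
    · simpa [hγs, hsource, hcoe] using And.intro hz hk
    · have hy' : y ∈ F.source ∧ F^[k] y ∈ e.source := by simpa [hγs, hsource, hcoe] using hy
      simpa [hγk, hcoe, Equiv.eq_symm_apply] using hψ y hy'.1 k hy'.2
  obtain ⟨Ψ, hΨ, hΨs, rfl⟩ := exists_mem_groupoid_of_injOn F.open_source hinj hloc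
  exact ⟨g, hg, Ψ, hΨ, hΨs, fun z hz => extension_semiconj hF.mapsTo hB.mapsTo hU hψ hz⟩

end IsHopfContraction

end DevelopingMap

/-! ### Geometric structures on quotients -/

section QuotientStructure

open Filter Set

variable {X M H : Type*} [TopologicalSpace X] [TopologicalSpace M] [TopologicalSpace H]
  {π : X → M}

/-- A local inverse of a local homeomorphism `π : X → M` near `x`, followed by a globally defined
chart `D` of `X`. -/
noncomputable def developingChart (hπ : IsLocalHomeomorph π) (D : OpenPartialHomeomorph X H)
    (x : X) : OpenPartialHomeomorph M H :=
  (hπ x).choose.symm.trans D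

lemma mem_source_choose (hπ : IsLocalHomeomorph π) (x : X) : x ∈ (hπ x).choose.source :=
  (hπ x).choose_spec.1

lemma coe_choose (hπ : IsLocalHomeomorph π) (x : X) : ⇑(hπ x).choose = π :=
  (hπ x).choose_spec.2.symm

/-- The atlas of developing charts on the base of a surjective local homeomorphism. -/
noncomputable abbrev developingChartedSpace (hπ : IsLocalHomeomorph π)
    (hs : Function.Surjective π) (D : OpenPartialHomeomorph X H) (hD : D.source = univ) :
    ChartedSpace H M where
  atlas := range (developingChart hπ D)
  chartAt m := developingChart hπ D (Function.surjInv hs m)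
  mem_chart_source m := by
    have hm := (hπ (Function.surjInv hs m)).choose.map_source (mem_source_choose hπ _)
    rw [coe_choose, Function.surjInv_eq hs] at hm
    simpa [developingChart, hD] using hm
  chart_mem_atlas _ := mem_range_self _

lemma exists_eventually_coordChange_eq {A B : OpenPartialHomeomorph X M} (hA : ⇑A = π)
    (hB : ⇑B = π) {D : OpenPartialHomeomorph X H} {G : Subgroup (Equiv.Perm H)}
    (hG : ∀ x y, π x = π y → ∃ g ∈ G, ∀ᶠ p in 𝓝 (x, y), π p.1 = π p.2 → D p.2 = g (D p.1))
    {u : H} (hu : u ∈ ((A.symm.trans D).symm.trans (B.symm.trans D)).source) :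
    ∃ g ∈ G, ∀ᶠ y in 𝓝 u, (A.symm.trans D).symm.trans (B.symm.trans D) y = g y := by
  let e := D.symm.trans (A.trans B.symm)
  have hue : u ∈ e.source := by
    simp only [OpenPartialHomeomorph.trans_symm_eq_symm_trans_symm, OpenPartialHomeomorph.symm_symm,
      ← OpenPartialHomeomorph.trans_assoc] at hu
    rw [OpenPartialHomeomorph.trans_source] at hu
    simpa only [e, OpenPartialHomeomorph.trans_assoc] using hu.1
  have hfib : ∀ y ∈ e.source, π (D.symm y) = π (e y) := fun y hy => by
    have hy' : A (D.symm y) ∈ B.target := by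
      simp only [e, OpenPartialHomeomorph.trans_source, mem_inter_iff, mem_preimage] at hy
      exact hy.2.2
    calc π (D.symm y) = B (B.symm (A (D.symm y))) := by rw [B.right_inv hy', hA]
      _ = π (e y) := by rw [hB]; rfl
  obtain ⟨g, hg, hgev⟩ := hG _ _ (hfib u hue)
  have hpair : ContinuousAt (fun y => (D.symm y, e y)) u :=
    (D.symm.continuousAt hue.1).prodMk (e.continuousAt hue)
  refine ⟨g, hg, ?_⟩
  filter_upwards [hpair.eventually hgev, e.open_source.mem_nhds hue] with y hy hye
  have hDy : D (e y) = g (D (D.symm y)) := hy (hfib y hye)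
  rwa [D.right_inv hye.1] at hDy

theorem hasGroupoid_developingChartedSpace (hπ : IsLocalHomeomorph π)
    (hs : Function.Surjective π) (D : OpenPartialHomeomorph X H) (hD : D.source = univ)
    {G : Subgroup (Equiv.Perm H)}
    (hG : ∀ x y, π x = π y → ∃ g ∈ G, ∀ᶠ p in 𝓝 (x, y), π p.1 = π p.2 → D p.2 = g (D p.1)) :
    @HasGroupoid H _ M _ (developingChartedSpace hπ hs D hD) (transformationGroupoid G) := by
  let _ := developingChartedSpace hπ hs D hD
  refine ⟨?_⟩
  rintro _ _ ⟨a, rfl⟩ ⟨b, rfl⟩ u hu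
  exact exists_eventually_coordChange_eq (coe_choose hπ a) (coe_choose hπ b) hG hu

variable {E : Type*} [NormedAddCommGroup E] [NormedSpace ℂ E] [ChartedSpace E X]

section MaximalAtlas

variable [ChartedSpace E M] {A : OpenPartialHomeomorph X M}
  {D : OpenPartialHomeomorph X E}

lemma contMDiffOn_of_symm_trans_mem_maximalAtlas (hD : D.source = univ)
    (hDs : ContMDiff 𝓘(ℂ, E) 𝓘(ℂ, E) ω D)
    (hA : A.symm.trans D ∈ IsManifold.maximalAtlas 𝓘(ℂ, E) ω M) :
    ContMDiffOn 𝓘(ℂ, E) 𝓘(ℂ, E) ω A A.source := by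
  have hinv : ∀ y, D.symm (D y) = y := fun y => D.left_inv (hD ▸ mem_univ y)
  refine ((contMDiffOn_symm_of_mem_maximalAtlas hA).comp (hDs.contMDiffOn (s := A.source))
    fun y hy => ?_).congr fun y _ => (congrArg A (hinv y)).symm
  exact ⟨D.map_source (hD ▸ mem_univ y), by simpa [hinv] using hy⟩

lemma contMDiffOn_symm_of_symm_trans_mem_maximalAtlas (hD : D.source = univ)
    (hDt : ContMDiffOn 𝓘(ℂ, E) 𝓘(ℂ, E) ω D.symm D.target)
    (hA : A.symm.trans D ∈ IsManifold.maximalAtlas 𝓘(ℂ, E) ω M) :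
    ContMDiffOn 𝓘(ℂ, E) 𝓘(ℂ, E) ω A.symm A.target := by
  have hmem : ∀ y, y ∈ D.source := fun y => hD ▸ mem_univ y
  exact (hDt.comp ((contMDiffOn_of_mem_maximalAtlas hA).mono (by simp [hD]))
    fun _ _ => D.map_source (hmem _)).congr fun _ _ => (D.left_inv (hmem _)).symm

end MaximalAtlas

theorem isLocalDiffeomorph_developingChartedSpace (hπ : IsLocalHomeomorph π)
    (hs : Function.Surjective π) (D : OpenPartialHomeomorph X E) (hD : D.source = univ)
    (hM : @IsManifold ℂ _ E _ _ E _ 𝓘(ℂ, E) ω M _ (developingChartedSpace hπ hs D hD))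
    (hDs : ContMDiff 𝓘(ℂ, E) 𝓘(ℂ, E) ω D)
    (hDt : ContMDiffOn 𝓘(ℂ, E) 𝓘(ℂ, E) ω D.symm D.target) :
    @IsLocalDiffeomorph ℂ _ E _ _ E _ _ E _ E _ 𝓘(ℂ, E) 𝓘(ℂ, E) X _ _ M _
      (developingChartedSpace hπ hs D hD) ω π := by
  let _ := developingChartedSpace hπ hs D hD
  intro x
  have hmax : developingChart hπ D x ∈ IsManifold.maximalAtlas 𝓘(ℂ, E) ω M :=
    IsManifold.subset_maximalAtlas (mem_range_self x)
  exact ⟨{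
    toPartialEquiv := (hπ x).choose.toPartialEquiv
    open_source := (hπ x).choose.open_source
    open_target := (hπ x).choose.open_target
    contMDiffOn_toFun := contMDiffOn_of_symm_trans_mem_maximalAtlas hD hDs hmax
    contMDiffOn_invFun := contMDiffOn_symm_of_symm_trans_mem_maximalAtlas hD hDt hmax },
    mem_source_choose hπ x, fun y _ => congrFun (coe_choose hπ x).symm y⟩

end QuotientStructure

/-! ### Hopf manifolds -/

section Hopf

open Filter Set

variable {n : ℕ} {F : OpenPartialHomeomorph (Cn n) (Cn n)}

lemma transformationGroupoid_le_contDiffGroupoid {E : Type*} [NormedAddCommGroup E]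
    [NormedSpace ℂ E] {G : Subgroup (Equiv.Perm E)} (hG : ∀ g ∈ G, ContDiff ℂ ω g) :
    transformationGroupoid G ≤ contDiffGroupoid ω 𝓘(ℂ, E) := by
  have hsmooth : ∀ e ∈ transformationGroupoid G, ContDiffOn ℂ ω e e.source := fun e he x hx => by
    obtain ⟨g, hg, hgx⟩ := he x hx
    exact ((hG g hg).contDiffAt.congr_of_eventuallyEq hgx).contDiffWithinAt
  exact fun e he => mem_contDiffGroupoid_self_iff.2
    ⟨hsmooth e he, hsmooth e.symm ((transformationGroupoid G).symm he)⟩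

namespace IsHopfContraction

/-- A Hopf contraction as a self-map of its punctured domain. -/
noncomputable def puncturedMap (hF : IsHopfContraction F) (z : puncturedSource F) :
    puncturedSource F :=
  ⟨F z, hF.mapsTo z.2.1, fun h => z.2.2 (F.injOn z.2.1 hF.zero_mem
    ((mem_singleton_iff.1 h).trans hF.map_zero.symm))⟩

lemma coe_iterate_puncturedMap (hF : IsHopfContraction F) (k : ℕ) (z : puncturedSource F) :
    (hF.puncturedMap^[k] z : Cn n) = F^[k] z :=
  Function.Semiconj.iterate_right (f := Subtype.val) (fun _ => rfl) k z

lemma injective_puncturedMap (hF : IsHopfContraction F) : Function.Injective hF.puncturedMap :=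
  fun z w h => Subtype.ext (F.injOn z.2.1 w.2.1 (congrArg Subtype.val h))

lemma continuous_puncturedMap (hF : IsHopfContraction F) : Continuous hF.puncturedMap :=
  (F.continuousOn.comp_continuous continuous_subtype_val fun z => z.2.1).subtype_mk _

lemma isOpenMap_puncturedMap (hF : IsHopfContraction F) : IsOpenMap hF.puncturedMap := by
  have hval := (puncturedSource F).isOpenEmbedding'
  refine hval.isOpenMap_iff.2 fun O hO => ?_
  have himage : IsOpen (F '' (Subtype.val '' O)) :=
    F.isOpen_image_of_subset_source (hval.isOpenMap O hO)
      (image_subset_iff.2 fun z _ => z.2.1)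
  rwa [← image_comp] at himage

lemma isWandering_puncturedMap (hF : IsHopfContraction F) : IsWandering hF.puncturedMap := by
  intro z w
  have hw : 0 < ‖(w : Cn n)‖ := norm_pos_iff.2 w.2.2
  obtain ⟨k₀, hk₀⟩ := hF.exists_eventually_norm_iterate_lt z.2.1 (half_pos hw)
  refine ⟨k₀, ?_⟩
  have hsmall : ∀ᶠ p : puncturedSource F × puncturedSource F in 𝓝 (z, w),
      ∀ k ≥ k₀, ‖F^[k] (p.1 : Cn n)‖ < ‖(w : Cn n)‖ / 2 :=
    ((continuous_subtype_val.comp continuous_fst).tendsto (z, w)).eventually hk₀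
  have hlarge : ∀ᶠ p : puncturedSource F × puncturedSource F in 𝓝 (z, w),
      ‖(w : Cn n)‖ / 2 < ‖(p.2 : Cn n)‖ :=
    ((continuous_norm.comp (continuous_subtype_val.comp continuous_snd)).tendsto
      (z, w)).eventually_const_lt (half_lt_self hw)
  filter_upwards [hsmall, hlarge] with p hp hp' k hk h
  refine lt_asymm hp' ?_
  rw [← h, hF.coe_iterate_puncturedMap]
  exact hp k hk

/-- The Hopf manifold as the orbit space of the punctured map. -/
def orbitSpaceHomeomorph (hF : IsHopfContraction F) :
    OrbitSpace hF.puncturedMap ≃ₜ HopfManifold F where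
  toEquiv := Quot.congrRight fun _ _ => Subtype.ext_iff
  continuous_toFun := continuous_quot_lift _ continuous_quot_mk
  continuous_invFun := continuous_quot_lift _ continuous_quot_mk

lemma orbitSpaceHomeomorph_comp_orbitMk (hF : IsHopfContraction F) :
    hF.orbitSpaceHomeomorph ∘ orbitMk hF.puncturedMap = hopfProj F :=
  rfl

lemma hopfProj_eq_iff_orbitMk_eq (hF : IsHopfContraction F) {z w : puncturedSource F} :
    hopfProj F z = hopfProj F w ↔ orbitMk hF.puncturedMap z = orbitMk hF.puncturedMap w :=
  hF.orbitSpaceHomeomorph.injective.eq_iff (a := orbitMk _ z) (b := orbitMk _ w)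

lemma isOpenQuotientMap_hopfProj (hF : IsHopfContraction F) : IsOpenQuotientMap (hopfProj F) :=
  hF.orbitSpaceHomeomorph_comp_orbitMk ▸ hF.orbitSpaceHomeomorph.isOpenQuotientMap.comp
    (isOpenQuotientMap_orbitMk hF.injective_puncturedMap hF.continuous_puncturedMap
      hF.isOpenMap_puncturedMap)

lemma isLocalHomeomorph_hopfProj (hF : IsHopfContraction F) : IsLocalHomeomorph (hopfProj F) :=
  hF.orbitSpaceHomeomorph_comp_orbitMk ▸ hF.orbitSpaceHomeomorph.isLocalHomeomorph.comp
    (hF.isWandering_puncturedMap.isLocalHomeomorph_orbitMk hF.injective_puncturedMap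
      hF.continuous_puncturedMap hF.isOpenMap_puncturedMap)

lemma t2Space_hopfManifold (hF : IsHopfContraction F) : T2Space (HopfManifold F) :=
  have := hF.isWandering_puncturedMap.t2Space_orbitSpace hF.injective_puncturedMap
    hF.continuous_puncturedMap hF.isOpenMap_puncturedMap
  hF.orbitSpaceHomeomorph.t2Space

lemma secondCountableTopology_hopfManifold (hF : IsHopfContraction F) :
    SecondCountableTopology (HopfManifold F) :=
  hF.isOpenQuotientMap_hopfProj.isQuotientMap.secondCountableTopology
    hF.isOpenQuotientMap_hopfProj.isOpenMap

lemma eventually_iterate_eq (hF : IsHopfContraction F) (x : puncturedSource F) (k : ℕ) :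
    ∀ᶠ p in 𝓝 (x, hF.puncturedMap^[k] x),
      hopfProj F p.1 = hopfProj F p.2 → hF.puncturedMap^[k] p.1 = p.2 := by
  simp only [hF.hopfProj_eq_iff_orbitMk_eq]
  exact hF.isWandering_puncturedMap.eventually_iterate_eq hF.injective_puncturedMap
    hF.continuous_puncturedMap x k

lemma exists_eventually_eq_of_hopfProj_eq (hF : IsHopfContraction F) {Y : Type*}
    {G : Subgroup (Equiv.Perm Y)} {g : Equiv.Perm Y} (hg : g ∈ G) {ψ : Cn n → Y}
    (hψ : ∀ z ∈ F.source, ψ (F z) = g (ψ z)) {x y : puncturedSource F}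
    (hxy : hopfProj F x = hopfProj F y) :
    ∃ h ∈ G, ∀ᶠ p in 𝓝 (x, y), hopfProj F p.1 = hopfProj F p.2 → ψ p.2 = h (ψ p.1) := by
  have hiter (k : ℕ) (z : puncturedSource F) : ψ (hF.puncturedMap^[k] z) = (g ^ k) (ψ z) := by
    rw [hF.coe_iterate_puncturedMap, semiconj_iterate hF.mapsTo hψ z.2.1]
  rw [hF.hopfProj_eq_iff_orbitMk_eq, orbitMk_eq_iff hF.injective_puncturedMap] at hxy
  obtain ⟨k, rfl | rfl⟩ := hxy
  · refine ⟨g ^ k, G.pow_mem hg k, ?_⟩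
    filter_upwards [hF.eventually_iterate_eq x k] with p hp hpp
    rw [← hp hpp, hiter]
  · refine ⟨(g ^ k)⁻¹, G.inv_mem (G.pow_mem hg k), ?_⟩
    filter_upwards [(continuous_swap.tendsto _).eventually (hF.eventually_iterate_eq y k)]
      with p hp hpp
    rw [Equiv.Perm.eq_inv_iff_eq, ← hiter]
    exact congrArg (fun z : puncturedSource F => ψ z) (hp hpp.symm)

end IsHopfContraction

lemma exists_chartedSpace_hopfManifold_of_isEmpty [IsEmpty (puncturedSource F)]
    (𝒢 : StructureGroupoid (Cn n)) :
    ∃ _ : ChartedSpace (Cn n) (HopfManifold F), HasGroupoid (HopfManifold F) 𝒢 ∧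
      IsManifold 𝓘(ℂ, Cn n) ω (HopfManifold F) ∧
      IsLocalDiffeomorph 𝓘(ℂ, Cn n) 𝓘(ℂ, Cn n) ω (hopfProj F) := by
  have : IsEmpty (HopfManifold F) := (Quot.mk_surjective (r := _)).isEmpty
  let _ := ChartedSpace.empty (Cn n) (HopfManifold F)
  have hgroupoid (𝒢 : StructureGroupoid (Cn n)) : HasGroupoid (HopfManifold F) 𝒢 :=
    ⟨fun {e} _ he => he.elim⟩
  have := hgroupoid (contDiffGroupoid ω 𝓘(ℂ, Cn n))
  exact ⟨_, hgroupoid 𝒢, .mk' _ _ _, fun x => isEmptyElim x⟩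

lemma exists_contMDiff_openPartialHomeomorph_opens {E : Type*} [NormedAddCommGroup E]
    [NormedSpace ℂ E] {O : TopologicalSpace.Opens E} [hO : Nonempty O]
    {Ψ : OpenPartialHomeomorph E E} (hΨ : Ψ ∈ contDiffGroupoid ω 𝓘(ℂ, E)) (hΨs : Ψ.source = O) :
    ∃ D : OpenPartialHomeomorph O E, D.source = univ ∧ (∀ z, D z = Ψ z) ∧
      ContMDiff 𝓘(ℂ, E) 𝓘(ℂ, E) ω D ∧ ContMDiffOn 𝓘(ℂ, E) 𝓘(ℂ, E) ω D.symm D.target := by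
  obtain ⟨hsmooth, hsmooth'⟩ := mem_contDiffGroupoid_self_iff.1 hΨ
  let D := (O.openPartialHomeomorphSubtypeCoe hO).trans Ψ
  have htarget : D.target ⊆ Ψ.target := inter_subset_left
  refine ⟨D, ?_, fun z => rfl, hsmooth.contMDiffOn.comp_contMDiff contMDiff_subtype_val
    fun z => hΨs.ge z.2, fun y hy => ?_⟩
  · ext z
    simp [D, hΨs]
  · have hval : ∀ w ∈ D.target, (D.symm w : E) = Ψ.symm w := fun w hw =>
      Ψ.injOn (hΨs.ge (D.symm w).2) (Ψ.map_target (htarget hw))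
        ((D.right_inv hw).trans (Ψ.right_inv (htarget hw)).symm)
    refine (ChartedSpace.liftPropWithinAt_subtypeVal_comp_iff (U := O) ..).1 ?_
    exact ((hsmooth'.contMDiffOn.mono htarget) y hy).congr_of_mem hval hy

theorem IsHopfContraction.exists_chartedSpace_hopfManifold (hF : IsHopfContraction F)
    {G : Subgroup (Equiv.Perm (Cn n))} (hG : ∀ g ∈ G, ContDiff ℂ ω g)
    {g : Equiv.Perm (Cn n)} (hg : g ∈ G) {Ψ : OpenPartialHomeomorph (Cn n) (Cn n)}
    (hΨ : Ψ ∈ contDiffGroupoid ω 𝓘(ℂ, Cn n)) (hΨs : Ψ.source = F.source)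
    (hΨF : ∀ z ∈ F.source, Ψ (F z) = g (Ψ z)) :
    ∃ _ : ChartedSpace (Cn n) (HopfManifold F),
      HasGroupoid (HopfManifold F) (transformationGroupoid G) ∧
      IsManifold 𝓘(ℂ, Cn n) ω (HopfManifold F) ∧
      IsLocalDiffeomorph 𝓘(ℂ, Cn n) 𝓘(ℂ, Cn n) ω (hopfProj F) := by
  rcases isEmpty_or_nonempty (puncturedSource F) with hX | hX
  · exact exists_chartedSpace_hopfManifold_of_isEmpty _
  obtain ⟨D, hD, hDΨ, hDs, hDt⟩ := exists_contMDiff_openPartialHomeomorph_opens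
    (O := puncturedSource F) (closedUnderRestriction' hΨ (puncturedSource F).isOpen) (by
      rw [OpenPartialHomeomorph.restr_source, (puncturedSource F).isOpen.interior_eq, hΨs]
      exact inter_eq_right.2 fun z hz => hz.1)
  have hπ := hF.isLocalHomeomorph_hopfProj
  have hsurj := hF.isOpenQuotientMap_hopfProj.surjective
  let _ := developingChartedSpace hπ hsurj D hD
  have hgroupoid : HasGroupoid (HopfManifold F) (transformationGroupoid G) :=
    hasGroupoid_developingChartedSpace hπ hsurj D hD fun x y hxy => by
      simpa only [hDΨ, OpenPartialHomeomorph.restr_apply]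
        using hF.exists_eventually_eq_of_hopfProj_eq hg hΨF hxy
  have := hasGroupoid_of_le hgroupoid (transformationGroupoid_le_contDiffGroupoid hG)
  have hM : IsManifold 𝓘(ℂ, Cn n) ω (HopfManifold F) := .mk' _ _ _
  exact ⟨_, hgroupoid, hM,
    isLocalDiffeomorph_developingChartedSpace hπ hsurj D hD hM hDs hDt⟩

end Hopf

theorem theorem4p3 (n : ℕ) (F : OpenPartialHomeomorph (Cn n) (Cn n)) (hF : IsHopfContraction F) :
    IsHolomorphicHomogeneousSpace (subResonantAffineGroup (linearPart F)) ∧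
    T2Space (HopfManifold F) ∧ SecondCountableTopology (HopfManifold F) ∧
    ∃ _ : ChartedSpace (Cn n) (HopfManifold F),
      -- the atlas is a `(G, X)`-structure, `X = ℂⁿ`, `G = ⟨SR*(L), ℂⁿ⟩`
      HasGroupoid (HopfManifold F)
        (transformationGroupoid (subResonantAffineGroup (linearPart F))) ∧
      -- it is holomorphic, and its complex structure is the quotient one
      IsManifold 𝓘(ℂ, Cn n) ω (HopfManifold F) ∧
      IsLocalDiffeomorph 𝓘(ℂ, Cn n) 𝓘(ℂ, Cn n) ω (hopfProj F) := by
  obtain ⟨g, hg, Ψ, hΨ, hΨs, hΨF⟩ := hF.exists_developingMap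
  exact ⟨isHolomorphicHomogeneousSpace_subResonantAffineGroup hF.eigenvalue_ne_zero
      fun j => hF.contracting j j.2,
    hF.t2Space_hopfManifold, hF.secondCountableTopology_hopfManifold,
    hF.exists_chartedSpace_hopfManifold (fun _ => hF.contDiff_of_mem) hg hΨ hΨs hΨF⟩
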